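/- Let $\mathbf D$ be an infinite set of domain values and $\mathbf X$ a set of variables, both written as bit strings by fixed injective encodings. A relational schema is a finite list of relation names $R$, each with a nonempty finite set of attributes; a database over it assigns to every $R$ a finite set of tuples over $\mathbf D$. A (tuple-level) gWSD over a schema is a pair $\mathcal W=(\{C_1,\dots,C_m\},\phi)$. Here $\phi$ is a finite conjunction of possibly negated equalities between elements of $\mathbf D\cup\mathbf X$. The $C_i$ (components) are finite, possibly empty, sets of rows with entries in $\mathbf D\cup\mathbf X\cup\{\bot\}$; their column sets are nonempty and pairwise disjoint, and consist of columns $R.d.A$ with $R$ a relation name, $d$ a tuple identifier and $A$ an attribute of $R$, where, together with one column $R.d.A$, the component contains $R.d.B$ for every attribute $B$ of $R$. A row $w\in C_1\times\dots\times C_m$ and a valuation $\nu:\mathbf X\to\mathbf D$ satisfying $\phi$ yield the database in which $R$ consists of the tuples $\nu(w(R.d))$, for all tuple identifiers $R.d$ of $\mathcal W$ such that no field of $w(R.d)$ is $\bot$. The set $\mathit{rep}(\mathcal W)$ of possible worlds consists of all databases obtained in this way. **Theorem.** Instance certainty is in PTIME for gWSDs: there are a Turing machine and a polynomial $p$ such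 that, given (a string encoding of) a schema, a gWSD $\mathcal W$ and a database $I$ over that schema, the machine decides in at most $p(n)$ steps, $n$ being the length of the input string, whether every world $\mathcal A\in\mathit{rep}(\mathcal W)$ is equal to $I$. -/

import Mathlib

namespace WSD

/-! ### Relational schemas and databases -/

/-- A relational schema `(R₁[U₁], …, Rₖ[Uₖ])`.  Relation names are the positions in the list; the
attribute set of `R`, which is nonempty, is `Fin (arity of R)`. -/
structure Schema where
  arities : List ℕ
  arities_pos : ∀ k ∈ arities, 0 < k

/-- The relation names of a schema. -/
abbrev Schema.Rel (S : Schema) : Type := Fin S.arities.length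

/-- The arity of a relation. -/
def Schema.arity (S : Schema) (R : S.Rel) : ℕ := S.arities.get R

/-- A tuple over the relation schema `R[U]` with entries in `V`. -/
abbrev Tuple (S : Schema) (R : S.Rel) (V : Type) : Type := Fin (S.arity R) → V

/-- A database over the schema: one relation (set of tuples of domain values) for every relation
name. (All databases that occur below, worlds and input instances, have finite relations.) -/
abbrev Database (S : Schema) (D : Type) : Type := (R : S.Rel) → Set (Tuple S R D)

/-! ### Terms, conditions, g-multitables -/

/-- A domain value or a variable, i.e. an element of `𝐃 ∪ 𝐗`. -/
inductive Term (D X : Type) where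
  | const (d : D)
  | var (x : X)

/-- Extension of a valuation to `𝐃 ∪ 𝐗`, the identity on domain values. -/
def Term.eval {D X : Type} (ν : X → D) : Term D X → D
  | .const d => d
  | .var x => ν x

/-- A possibly negated equality: `lhs = rhs` if `positive` is true, `lhs ≠ rhs` otherwise. -/
structure Literal (D X : Type) where
  positive : Bool
  lhs : Term D X
  rhs : Term D X

/-- Truth of a literal under a valuation. -/
def Literal.Holds {D X : Type} (ν : X → D) (l : Literal D X) : Prop :=
  if l.positive = true then l.lhs.eval ν = l.rhs.eval ν else l.lhs.eval ν ≠ l.rhs.eval ν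

/-- A conjunction of possibly negated equalities (the empty conjunction is "true"). -/
abbrev Condition (D X : Type) : Type := List (Literal D X)

/-- Truth of a condition under a valuation. -/
def Condition.Holds {D X : Type} (ν : X → D) (φ : Condition D X) : Prop :=
  ∀ l ∈ φ, l.Holds ν

/-- A g-multitable: one table over `𝐃 ∪ 𝐗` for every relation name, and a global condition. -/
structure GMultitable (S : Schema) (D X : Type) where
  table : (R : S.Rel) → Set (Tuple S R (Term D X))
  cond : Condition D X

/-- The database `ν(𝒯)`. -/
def GMultitable.apply {S : Schema} {D X : Type} (T : GMultitable S D X) (ν : X → D) :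
    Database S D :=
  fun R => (fun t : Tuple S R (Term D X) => fun j => (t j).eval ν) '' T.table R

/-- The representation of a g-multitable: all `ν(𝒯)` for the satisfactions `ν`. -/
def GMultitable.rep {S : Schema} {D X : Type} (T : GMultitable S D X) : Set (Database S D) :=
  {A | ∃ ν : X → D, T.cond.Holds ν ∧ A = T.apply ν}

/-! ### Tabset tables and their (tuple-level) decompositions -/

/-- A field of a tabset table: a domain value, a variable, or `⊥` (which is `none`). -/
abbrev Field (D X : Type) : Type := Option (Term D X)

/-- A tuple identifier `R.d`; it stands for the group of columns `R.d.A`, `A` an attribute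
of `R`. -/
structure TupleId (S : Schema) where
  rel : S.Rel
  num : ℕ

/-- A row over the columns `R.d.A` with `R.d` in the list `L` and `A` an attribute of `R`. -/
abbrev Row (S : Schema) (D X : Type) (L : List (TupleId S)) : Type :=
  (s : {s : TupleId S // s ∈ L}) → Tuple S s.1.rel (Field D X)

/-- The g-multitable `inline⁻¹(w)` with the global condition `φ`: the tuple with identifier `R.d`
is dropped if one of its fields is `⊥`. -/
def uninline {S : Schema} {D X : Type} {L : List (TupleId S)} (w : Row S D X L)
    (φ : Condition D X) : GMultitable S D X where
  table R := {t | ∃ (d : ℕ) (h : TupleId.mk R d ∈ L), ∀ j, w ⟨⟨R, d⟩, h⟩ j = some (t j)}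
  cond := φ

/-- The representation of the gTST `(W, φ)`, where `W` is a table over the columns given
by `L`. -/
def repGTST {S : Schema} {D X : Type} {L : List (TupleId S)} (W : Set (Row S D X L))
    (φ : Condition D X) : Set (Database S D) :=
  ⋃ w ∈ W, (uninline w φ).rep

/-- A component of a tuple-level decomposition. Its column set is nonempty and contains, with one
column `R.d.A`, all columns `R.d.B`, so it is given by a list of tuple identifiers. Its finite
set of rows is given by a list; order and repetitions are irrelevant. -/
structure Component (S : Schema) (D X : Type) where
  ids : List (TupleId S)
  ids_ne_nil : ids ≠ []
  rows : List (Row S D X ids)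

/-- A tuple-level gWSD `({C₁, …, Cₘ}, φ)`: components with pairwise disjoint sets of columns, and
a global condition. -/
structure GWSD (S : Schema) (D X : Type) where
  comps : List (Component S D X)
  nodup : (comps.flatMap Component.ids).Nodup
  cond : Condition D X

/-- All tuple identifiers of a gWSD. -/
def GWSD.ids {S : Schema} {D X : Type} (W : GWSD S D X) : List (TupleId S) :=
  W.comps.flatMap Component.ids

/-- The relational product `C₁ × ⋯ × Cₘ` of the components. -/
def GWSD.product {S : Schema} {D X : Type} (W : GWSD S D X) : Set (Row S D X W.ids) :=
  {w | ∀ (C : Component S D X) (hC : C ∈ W.comps),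
    (fun s : {s : TupleId S // s ∈ C.ids} =>
      w ⟨s.1, List.mem_flatMap.2 ⟨C, hC, s.2⟩⟩) ∈ C.rows}

/-- The set of possible worlds of a gWSD. -/
def GWSD.rep {S : Schema} {D X : Type} (W : GWSD S D X) : Set (Database S D) :=
  repGTST W.product W.cond

/-! ### Instance certainty -/

/-- An input instance: a database given by the list of its facts `R(t)`. -/
abbrev Instance (S : Schema) (D : Type) : Type := List ((R : S.Rel) × Tuple S R D)

/-- The database denoted by an input instance. -/
def Instance.toDatabase {S : Schema} {D : Type} (I : Instance S D) : Database S D :=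
  fun R => {t | (⟨R, t⟩ : (R : S.Rel) × Tuple S R D) ∈ I}

/-- An input of the instance certainty problem: a schema, a gWSD and an instance over it. -/
structure Input (D X : Type) where
  schema : Schema
  wsd : GWSD schema D X
  inst : Instance schema D

/-- Instance certainty: every world of the gWSD equals the given instance. -/
def InstanceCertain {D X : Type} (p : Input D X) : Prop :=
  ∀ A ∈ p.wsd.rep, p.inst.toDatabase = A

/-! ### Inputs as strings

Domain values and variables are written as bit strings by means of `eD` and `eX`; numbers are
written in binary. -/

/-- The finite input alphabet. -/
inductive Sym where
  | bit (b : Bool)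
  | eow | const | var | bot | eq | ne | arity | comp | row | tup | lit | close
  deriving DecidableEq, Fintype

/-- A bit string, followed by an end marker. -/
def encBits (w : List Bool) : List Sym := w.map Sym.bit ++ [Sym.eow]

/-- A number in binary. -/
def encNat (n : ℕ) : List Sym := encBits (Computability.encodeNat n)

/-- A list: every entry is preceded by the symbol `o`, the end is marked by `close`. -/
def encList {α : Type} (o : Sym) (enc : α → List Sym) (l : List α) : List Sym :=
  l.flatMap (fun a => o :: enc a) ++ [Sym.close]

/-- A domain value or variable. -/
def encTerm {D X : Type} (eD : D ↪ List Bool) (eX : X ↪ List Bool) : Term D X → List Sym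
  | .const d => Sym.const :: encBits (eD d)
  | .var x => Sym.var :: encBits (eX x)

/-- A field. -/
def encField {D X : Type} (eD : D ↪ List Bool) (eX : X ↪ List Bool) : Field D X → List Sym
  | none => [Sym.bot]
  | some t => encTerm eD eX t

/-- A possibly negated equality. -/
def encLiteral {D X : Type} (eD : D ↪ List Bool) (eX : X ↪ List Bool) (l : Literal D X) :
    List Sym :=
  (if l.positive = true then Sym.eq else Sym.ne) :: (encTerm eD eX l.lhs ++ encTerm eD eX l.rhs)

/-- A tuple identifier `R.d`. -/
def encId {S : Schema} (s : TupleId S) : List Sym := encNat s.num ++ encNat s.rel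

/-- The entries of a tuple, one after the other. -/
def encTuple {V : Type} {n : ℕ} (enc : V → List Sym) (t : Fin n → V) : List Sym :=
  (List.ofFn t).flatMap enc

/-- A row: its tuples one after the other, each preceded by its identifier. -/
def encRow {S : Schema} {D X : Type} (eD : D ↪ List Bool) (eX : X ↪ List Bool)
    {L : List (TupleId S)} (w : Row S D X L) : List Sym :=
  L.attach.flatMap (fun s => Sym.tup :: (encId s.1 ++ encTuple (encField eD eX) (w s))) ++
    [Sym.close]

/-- A component: the list of its tuple identifiers, then its rows. -/
def encComponent {S : Schema} {D X : Type} (eD : D ↪ List Bool) (eX : X ↪ List Bool)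
    (C : Component S D X) : List Sym :=
  encList Sym.tup encId C.ids ++ encList Sym.row (encRow eD eX) C.rows

/-- A gWSD: the list of its components, then its global condition. -/
def encGWSD {S : Schema} {D X : Type} (eD : D ↪ List Bool) (eX : X ↪ List Bool)
    (W : GWSD S D X) : List Sym :=
  encList Sym.comp (encComponent eD eX) W.comps ++ encList Sym.lit (encLiteral eD eX) W.cond

/-- A schema: the list of its arities. -/
def encSchema (S : Schema) : List Sym := encList Sym.arity encNat S.arities

/-- A fact `R(t)`. -/
def encFact {S : Schema} {D : Type} (eD : D ↪ List Bool) (f : (R : S.Rel) × Tuple S R D) :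
    List Sym :=
  encNat f.1 ++ encTuple (fun d => Sym.const :: encBits (eD d)) f.2

/-- An input of the instance certainty problem. -/
def encInput {D X : Type} (eD : D ↪ List Bool) (eX : X ↪ List Bool) (p : Input D X) : List Sym :=
  encSchema p.schema ++ encGWSD eD eX p.wsd ++ encList Sym.tup (encFact eD) p.inst

/-! ### Different inputs have different encodings -/

/-- An encoding whose code words can be read off unambiguously from the left. -/
def SelfDelim {α : Type} (enc : α → List Sym) : Prop :=
  ∀ x y r s, enc x ++ r = enc y ++ s → x = y ∧ r = s

theorem selfDelim_encBits : SelfDelim encBits := by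
  intro x
  induction x with
  | nil =>
    intro y r s h
    cases y <;> simp_all [encBits]
  | cons a x ih =>
    intro y r s h
    cases y with
    | nil => simp [encBits] at h
    | cons b y =>
      have h' : a = b ∧ encBits x ++ r = encBits y ++ s := by simpa [encBits] using h
      obtain ⟨h1, h2⟩ := ih y r s h'.2
      exact ⟨by rw [h'.1, h1], h2⟩

theorem selfDelim_encNat : SelfDelim encNat := by
  intro x y r s h
  obtain ⟨h1, h2⟩ := selfDelim_encBits _ _ r s h
  refine ⟨?_, h2⟩
  rw [← Computability.decode_encodeNat x, h1, Computability.decode_encodeNat]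

theorem selfDelim_encList {α : Type} {o : Sym} (ho : o ≠ Sym.close) {enc : α → List Sym}
    (he : SelfDelim enc) : SelfDelim (encList o enc) := by
  intro x
  induction x with
  | nil =>
    intro y r s h
    cases y with
    | nil => simpa [encList] using h
    | cons b y => simp [encList, ho.symm] at h
  | cons a x ih =>
    intro y r s h
    cases y with
    | nil => simp [encList, ho] at h
    | cons b y =>
      have h' : enc a ++ (encList o enc x ++ r) = enc b ++ (encList o enc y ++ s) := by
        simpa [encList] using h
      obtain ⟨h1, h2⟩ := he _ _ _ _ h'
      obtain ⟨h3, h4⟩ := ih _ _ _ h2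
      exact ⟨by rw [h1, h3], h4⟩

theorem flatMap_inj {β : Type} {f g : β → List Sym} {P : β → Prop}
    (H : ∀ b r s, f b ++ r = g b ++ s → P b ∧ r = s) (l : List β) :
    ∀ r s, l.flatMap f ++ r = l.flatMap g ++ s → (∀ b ∈ l, P b) ∧ r = s := by
  induction l with
  | nil => intro r s h; simpa using h
  | cons b l ih =>
    intro r s h
    have h' : f b ++ (l.flatMap f ++ r) = g b ++ (l.flatMap g ++ s) := by simpa using h
    obtain ⟨h1, h2⟩ := H _ _ _ h'
    obtain ⟨h3, h4⟩ := ih _ _ h2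
    exact ⟨by simpa using ⟨h1, h3⟩, h4⟩

theorem selfDelim_encTuple {V : Type} {n : ℕ} {enc : V → List Sym} (he : SelfDelim enc) :
    SelfDelim (encTuple (n := n) enc) := by
  intro x y r s h
  have key : (List.finRange n).flatMap (fun j => enc (x j)) ++ r =
      (List.finRange n).flatMap (fun j => enc (y j)) ++ s := by
    simpa [encTuple, List.ofFn_eq_map, List.flatMap_map] using h
  obtain ⟨h1, h2⟩ := flatMap_inj (P := fun j => x j = y j) (fun j r s h => he _ _ r s h) _ r s key
  exact ⟨funext fun j => h1 j (List.mem_finRange j), h2⟩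

theorem selfDelim_encTerm {D X : Type} (eD : D ↪ List Bool) (eX : X ↪ List Bool) :
    SelfDelim (encTerm eD eX) := by
  intro x y r s h
  cases x <;> cases y <;> simp only [encTerm, List.cons_append, List.cons.injEq, reduceCtorEq,
    false_and, true_and] at h
  all_goals
    obtain ⟨h1, h2⟩ := selfDelim_encBits _ _ r s h
    exact ⟨by simpa using h1, h2⟩

theorem selfDelim_encField {D X : Type} (eD : D ↪ List Bool) (eX : X ↪ List Bool) :
    SelfDelim (encField eD eX) := by
  intro x y r s h
  rcases x with _ | x <;> rcases y with _ | y
  · simpa [encField] using h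
  · cases y <;> simp [encField, encTerm] at h
  · cases x <;> simp [encField, encTerm] at h
  · obtain ⟨h1, h2⟩ := selfDelim_encTerm eD eX x y r s h
    exact ⟨by rw [h1], h2⟩

theorem selfDelim_encLiteral {D X : Type} (eD : D ↪ List Bool) (eX : X ↪ List Bool) :
    SelfDelim (encLiteral eD eX) := by
  rintro ⟨b, l1, l2⟩ ⟨c, m1, m2⟩ r s h
  have h' : b = c ∧ encTerm eD eX l1 ++ (encTerm eD eX l2 ++ r) =
      encTerm eD eX m1 ++ (encTerm eD eX m2 ++ s) := by
    cases b <;> cases c <;> simpa [encLiteral] using h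
  obtain ⟨h1, h2⟩ := selfDelim_encTerm eD eX _ _ _ _ h'.2
  obtain ⟨h3, h4⟩ := selfDelim_encTerm eD eX _ _ _ _ h2
  exact ⟨by rw [h'.1, h1, h3], h4⟩

theorem selfDelim_encId {S : Schema} : SelfDelim (encId (S := S)) := by
  rintro ⟨R, d⟩ ⟨R', d'⟩ r s h
  simp only [encId, List.append_assoc] at h
  obtain ⟨h1, h2⟩ := selfDelim_encNat _ _ _ _ h
  obtain ⟨h3, h4⟩ := selfDelim_encNat _ _ _ _ h2
  exact ⟨by rw [h1, Fin.ext h3], h4⟩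

theorem selfDelim_encRow {S : Schema} {D X : Type} (eD : D ↪ List Bool) (eX : X ↪ List Bool)
    {L : List (TupleId S)} : SelfDelim (encRow (L := L) eD eX) := by
  intro w w' r s h
  simp only [encRow, List.append_assoc] at h
  obtain ⟨h1, h2⟩ := flatMap_inj (P := fun b => w b = w' b) (by
    intro b r s h
    simp only [List.cons_append, List.cons.injEq, true_and, List.append_assoc,
      List.append_cancel_left_eq] at h
    exact selfDelim_encTuple (selfDelim_encField eD eX) _ _ _ _ h) _ _ _ h
  exact ⟨funext fun b => h1 b (List.mem_attach _ b), by simpa using h2⟩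

theorem selfDelim_encComponent {S : Schema} {D X : Type} (eD : D ↪ List Bool)
    (eX : X ↪ List Bool) : SelfDelim (encComponent (S := S) eD eX) := by
  rintro ⟨L, hL, rows⟩ ⟨L', hL', rows'⟩ r s h
  simp only [encComponent, List.append_assoc] at h
  obtain ⟨h1, h2⟩ := selfDelim_encList (by decide) selfDelim_encId _ _ _ _ h
  subst h1
  obtain ⟨h3, h4⟩ := selfDelim_encList (by decide) (selfDelim_encRow eD eX) _ _ _ _ h2
  exact ⟨by rw [h3], h4⟩

theorem selfDelim_encGWSD {S : Schema} {D X : Type} (eD : D ↪ List Bool)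
    (eX : X ↪ List Bool) : SelfDelim (encGWSD (S := S) eD eX) := by
  rintro ⟨cs, hc, φ⟩ ⟨cs', hc', φ'⟩ r s h
  simp only [encGWSD, List.append_assoc] at h
  obtain ⟨h1, h2⟩ := selfDelim_encList (by decide) (selfDelim_encComponent eD eX) _ _ _ _ h
  obtain ⟨h3, h4⟩ := selfDelim_encList (by decide) (selfDelim_encLiteral eD eX) _ _ _ _ h2
  subst h1 h3
  exact ⟨rfl, h4⟩

theorem selfDelim_encSchema : SelfDelim encSchema := by
  rintro ⟨a, ha⟩ ⟨b, hb⟩ r s h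
  obtain ⟨h1, h2⟩ := selfDelim_encList (by decide) selfDelim_encNat _ _ _ _ h
  subst h1
  exact ⟨rfl, h2⟩

theorem selfDelim_encFact {S : Schema} {D : Type} (eD : D ↪ List Bool) :
    SelfDelim (encFact (S := S) eD) := by
  rintro ⟨R, t⟩ ⟨R', t'⟩ r s h
  simp only [encFact, List.append_assoc] at h
  obtain ⟨h1, h2⟩ := selfDelim_encNat _ _ _ _ h
  have h1' := Fin.ext h1
  subst h1'
  obtain ⟨h3, h4⟩ := selfDelim_encTuple (by
    intro x y r s h
    simp only [List.cons_append, List.cons.injEq, true_and] at h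
    obtain ⟨h1, h2⟩ := selfDelim_encBits _ _ r s h
    exact ⟨eD.injective h1, h2⟩) _ _ _ _ h2
  exact ⟨by rw [h3], h4⟩

theorem encInput_injective {D X : Type} (eD : D ↪ List Bool) (eX : X ↪ List Bool) :
    Function.Injective (encInput eD eX) := by
  rintro ⟨S, W, I⟩ ⟨S', W', I'⟩ h
  simp only [encInput, List.append_assoc] at h
  obtain ⟨h1, h2⟩ := selfDelim_encSchema _ _ _ _ h
  subst h1
  obtain ⟨h3, h4⟩ := selfDelim_encGWSD eD eX _ _ _ _ h2
  obtain ⟨h5, -⟩ := selfDelim_encList (o := Sym.tup) (by decide) (selfDelim_encFact eD) I I' [] []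
    (by simpa using h4)
  rw [h3, h5]

/-! ### Polynomial time -/

/-- A decision problem on `α` is in PTIME with respect to an encoding of its inputs by strings:
a Turing machine outputs its truth value within polynomially many steps in the length of the
encoded input. -/
def InPTIME {α Γ : Type} (enc : α → List Γ) (P : α → Prop) : Prop :=
  ∃ f : α → Bool, (∀ a, f a = true ↔ P a) ∧
    Nonempty (Turing.TM2ComputableInPolyTime enc Computability.encodeBool f)

end WSD

/-! The equalities of the global condition involve only constants and variables, so they are solved
by successive substitutions, as in unification without function symbols. The condition is
unsatisfiable exactly if two distinct constants get equated or both sides of an inequality become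
the same term (`Condition.Bad`). Otherwise, as the domain is infinite and the set of variables
countable, the variables left free can receive distinct values outside any given finite set
(`Condition.exists_holds`). Under such a generic valuation a term takes a value occurring in `I`
only if the equations force it to.

This gives a criterion that never enumerates the product of the components (`instanceCertain_iff`).
If a component is empty or the condition is contradictory, there are no worlds. Otherwise `I` is
certain iff every tuple without `⊥`, in every row, is forced to be a fact of `I`, and every fact has
a single component each of whose rows contains a tuple forced to be that fact. One component must
suffice: if each had a row missing the fact, these rows could be chosen simultaneously, and the
generic valuation would yield a world without the fact.

For the running time, structured stack programs are compiled to `TM2` machines (`Run.steps`). Data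
are trees in Polish notation on a work stack, and `PolyTime` is closed under composition, pairing,
case distinction and folds with polynomially bounded states (`PolyTime.foldl`). Substitution only
selects among existing terms, so solving never produces large ones (`size_solve_le`). A
right-to-left reader turns the input string into lists of tokens, on which `certain` evaluates the
criterion; injectivity of the tokens transfers it to terms (`decideParse_iff`). -/

namespace StackMachine

open Turing Function

/-! ### A structured programming language for stacks, compiled to `TM2` -/

/-- Structured programs that work on a family of stacks with alphabets `Γ k`. -/
inductive Prog {K : Type} (Γ : K → Type) where
  | skip
  | push (k : K) (a : Γ k)
  | pop (k : K)
  | seq (P Q : Prog Γ)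
  | ite (k : K) (p : Option (Γ k) → Bool) (P Q : Prog Γ)
  | loop (k : K) (p : Option (Γ k) → Bool) (P : Prog Γ)

namespace Prog

variable {K : Type} {Γ : K → Type}

/-- `Run P S S' n`: the program `P`, started with stacks `S`, ends with stacks `S'` after `n`
steps. -/
inductive Run [DecidableEq K] : Prog Γ → (∀ k, List (Γ k)) → (∀ k, List (Γ k)) → ℕ → Prop where
  | skip {S} : Run skip S S 1
  | push {k a S} : Run (push k a) S (update S k (a :: S k)) 1
  | pop {k S} : Run (pop k) S (update S k (S k).tail) 1
  | seq {P Q S S' S'' m n} : Run P S S' m → Run Q S' S'' n → Run (seq P Q) S S'' (m + n)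
  | ite_true {k p P Q S S' n} : p (S k).head? = true → Run P S S' n →
      Run (ite k p P Q) S S' (n + 1)
  | ite_false {k p P Q S S' n} : p (S k).head? = false → Run Q S S' n →
      Run (ite k p P Q) S S' (n + 1)
  | loop_false {k p P S} : p (S k).head? = false → Run (loop k p P) S S 1
  | loop_true {k p P S S' S'' m n} : p (S k).head? = true → Run P S S' m →
      Run (loop k p P) S' S'' n → Run (loop k p P) S S'' (m + n + 1)

/-- The labels of the machine of a program. -/
def Label : Prog Γ → Type
  | skip => Unit
  | push _ _ => Unit
  | pop _ => Unit
  | seq P Q => Label P ⊕ Label Q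
  | ite _ _ P Q => Option (Label P ⊕ Label Q)
  | .loop _ _ P => Option (Label P)

/-- The label at which the execution of a program starts. -/
def entry : (P : Prog Γ) → Label P
  | skip => ()
  | push _ _ => ()
  | pop _ => ()
  | seq P _ => Sum.inl (entry P)
  | ite _ _ _ _ => none
  | .loop _ _ _ => none

instance labelFintype : (P : Prog Γ) → Fintype (Label P)
  | skip => inferInstanceAs (Fintype Unit)
  | push _ _ => inferInstanceAs (Fintype Unit)
  | pop _ => inferInstanceAs (Fintype Unit)
  | seq P Q =>
    let _ := labelFintype P
    let _ := labelFintype Q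
    inferInstanceAs (Fintype (Label P ⊕ Label Q))
  | ite _ _ P Q =>
    let _ := labelFintype P
    let _ := labelFintype Q
    inferInstanceAs (Fintype (Option (Label P ⊕ Label Q)))
  | .loop _ _ P =>
    let _ := labelFintype P
    inferInstanceAs (Fintype (Option (Label P)))

/-- Jump to one of two labels, depending on the top of a stack. -/
def test {Λ : Type} (k : K) (p : Option (Γ k) → Bool) (l₁ l₂ : Λ) : TM2.Stmt Γ Λ Bool :=
  .peek k (fun _ o => p o) (.branch id
    -- The internal state is reset, because `Run.steps` has every fragment start and end in state
    -- `false`.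
    (.load (fun _ => false) (.goto fun _ => l₁)) (.load (fun _ => false) (.goto fun _ => l₂)))

/-- The machine code of a program inside a machine with labels `Λ`, with a given exit label. -/
def code {Λ : Type} : (P : Prog Γ) → (Label P → Λ) → Λ → Label P → TM2.Stmt Γ Λ Bool
  | skip, _, e, _ => .goto fun _ => e
  | push k a, _, e, _ => .push k (fun _ => a) (.goto fun _ => e)
  | pop k, _, e, _ => .pop k (fun v _ => v) (.goto fun _ => e)
  | seq P Q, φ, _, .inl l => code P (fun l => φ (.inl l)) (φ (.inr (entry Q))) l
  | seq _ Q, φ, e, .inr l => code Q (fun l => φ (.inr l)) e l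
  | ite k p P Q, φ, _, none =>
    test k p (φ (some (Sum.inl (entry P)))) (φ (some (Sum.inr (entry Q))))
  | ite _ _ P _, φ, e, some (.inl l) => code P (fun l => φ (some (Sum.inl l))) e l
  | ite _ _ _ Q, φ, e, some (.inr l) => code Q (fun l => φ (some (Sum.inr l))) e l
  | .loop k p P, φ, e, none => test k p (φ (some (entry P))) e
  | .loop _ _ P, φ, _, some l => code P (fun l => φ (some l)) (φ none) l

/-! ### Correctness of the compilation -/

/-- `n` steps of a machine. -/
inductive Steps [DecidableEq K] {Λ σ : Type} (M : Λ → TM2.Stmt Γ Λ σ) :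
    ℕ → TM2.Cfg Γ Λ σ → TM2.Cfg Γ Λ σ → Prop where
  | refl {c} : Steps M 0 c c
  | head {n c c' c''} : TM2.step M c = some c' → Steps M n c' c'' → Steps M (n + 1) c c''

variable [DecidableEq K]

theorem Steps.trans {Λ σ : Type} {M : Λ → TM2.Stmt Γ Λ σ} {m n : ℕ} {c c' c'' : TM2.Cfg Γ Λ σ}
    (h : Steps M m c c') (h' : Steps M n c' c'') : Steps M (m + n) c c'' := by
  induction h with
  | refl => simpa using h'
  | head e _ ih => rw [Nat.add_right_comm]; exact .head e (ih h')

theorem Steps.single {Λ σ : Type} {M : Λ → TM2.Stmt Γ Λ σ} {c c' : TM2.Cfg Γ Λ σ}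
    (h : TM2.step M c = some c') : Steps M 1 c c' := .head h .refl

/-- This is the form in which Mathlib counts the steps of a computation. -/
theorem Steps.iterate {Λ σ : Type} {M : Λ → TM2.Stmt Γ Λ σ} {n : ℕ} {c c' : TM2.Cfg Γ Λ σ}
    (h : Steps M n c c') : (flip bind (TM2.step M))^[n] (some c) = some c' := by
  induction h with
  | refl => rfl
  | head e _ ih => rw [Function.iterate_succ_apply, ← ih]; simp [flip, e]

/-- The machine code of a program executes the program. -/
theorem Run.steps {P : Prog Γ} {S S' : ∀ k, List (Γ k)} {n : ℕ} (h : Run P S S' n) {Λ : Type}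
    (M : Λ → TM2.Stmt Γ Λ Bool) (φ : Label P → Λ) (e : Λ) (hM : ∀ l, M (φ l) = code P φ e l) :
    Steps M n ⟨some (φ (entry P)), false, S⟩ ⟨some e, false, S'⟩ := by
  induction h generalizing e with
  | skip => exact .single (by rw [TM2.step, hM]; rfl)
  | push => exact .single (by rw [TM2.step, hM]; rfl)
  | pop => exact .single (by rw [TM2.step, hM]; rfl)
  | seq _ _ ihP ihQ =>
    exact (ihP (fun l => φ (.inl l)) _ fun l => hM (.inl l)).trans
      (ihQ (fun l => φ (.inr l)) _ fun l => hM (.inr l))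
  | ite_true hp _ ih =>
    refine .head ?_ (ih (fun l => φ (some (Sum.inl l))) _ fun l => hM (some (.inl l)))
    rw [TM2.step, hM]
    simp [entry, code, test, hp]
  | ite_false hp _ ih =>
    refine .head ?_ (ih (fun l => φ (some (Sum.inr l))) _ fun l => hM (some (.inr l)))
    rw [TM2.step, hM]
    simp [entry, code, test, hp]
  | loop_false hp =>
    refine .single ?_
    rw [TM2.step, hM]
    simp [entry, code, test, hp]
  | loop_true hp _ _ ih ih' =>
    -- The body exits to the label `none` of the loop test, so the remaining iterations run in the
    -- same code with the same exit.
    refine .head ?_ ((ih (fun l => φ (some l)) _ fun l => hM (some l)).trans (ih' φ e hM))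
    rw [TM2.step, hM]
    simp [entry, code, test, hp]

/-- The machine of a program: it runs the program and halts. -/
def machine (P : Prog Γ) : Option (Label P) → TM2.Stmt Γ (Option (Label P)) Bool
  | some l => code P some none l
  | none => .halt

/-- The additional step executes `.halt` at the exit label `none`. -/
theorem Run.machine {P : Prog Γ} {S S' : ∀ k, List (Γ k)} {n : ℕ} (h : Run P S S' n) :
    Steps P.machine (n + 1) ⟨some (some (entry P)), false, S⟩ ⟨none, false, S'⟩ :=
  (h.steps P.machine some none fun _ => rfl).trans (.single rfl)

end Prog

/-! ### Trees as data -/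

/-- Binary trees, the data on which programs operate. -/
inductive Val where
  | leaf
  | node (a b : Val)

/-- The symbols of the work stacks. -/
inductive Tok where
  | leaf | node | mark

/-- The Polish notation of a tree. -/
def Val.code : Val → List Tok
  | leaf => [.leaf]
  | node a b => .node :: (a.code ++ b.code)

/-- The length of the Polish notation of a tree. -/
def Val.size : Val → ℕ
  | leaf => 1
  | node a b => a.size + b.size + 1

theorem Val.length_code : ∀ v : Val, v.code.length = v.size
  | leaf => rfl
  | node a b => by simp [code, size, length_code a, length_code b]

/-- This lets `Tok.mark` delimit a tree on a stack: draining down to the first mark removes exactly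
that tree. -/
theorem Val.mark_notMem_code : ∀ v : Val, Tok.mark ∉ v.code
  | leaf => by simp [code]
  | node a b => by simp [code, mark_notMem_code a, mark_notMem_code b]

theorem Val.size_pos : ∀ v : Val, 0 < v.size
  | leaf => by simp [size]
  | node _ _ => by simp [size]

/-- The stacks: input, output, the main work stack, two auxiliary stacks and a counter. -/
inductive Stk where
  | inp | out | main | aux | tmp | cnt
  deriving DecidableEq

instance : Fintype Stk where
  elems := {.inp, .out, .main, .aux, .tmp, .cnt}
  complete k := by cases k <;> simp

/-- The stack alphabets, for input over `I`. -/
def Alphabet (I : Type) : Stk → Type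
  | .inp => I
  | .out => Bool
  | _ => Tok

variable {I : Type}

/-- The stack contents, as a function of the six stacks. -/
def st (i : List I) (o : List Bool) (m a b c : List Tok) : (k : Stk) → List (Alphabet I k)
  | .inp => i
  | .out => o
  | .main => m
  | .aux => a
  | .tmp => b
  | .cnt => c

/-! ### Programs with upper bounds on their running time -/

namespace Prog

/-- The program `P` leads from `S` to `S'` in at most `n` steps. -/
def RunLe (P : Prog (Alphabet I)) (S S' : ∀ k, List (Alphabet I k)) (n : ℕ) : Prop :=
  ∃ t ≤ n, Run P S S' t

variable {P Q : Prog (Alphabet I)} {S S' S'' : ∀ k, List (Alphabet I k)} {m n : ℕ}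

theorem RunLe.mono (h : RunLe P S S' m) (hmn : m ≤ n) : RunLe P S S' n :=
  let ⟨t, ht, hr⟩ := h
  ⟨t, ht.trans hmn, hr⟩

theorem RunLe.seq (h : RunLe P S S' m) (h' : RunLe Q S' S'' n) : RunLe (P.seq Q) S S'' (m + n) :=
  let ⟨t, ht, hr⟩ := h
  let ⟨t', ht', hr'⟩ := h'
  ⟨t + t', Nat.add_le_add ht ht', .seq hr hr'⟩

theorem RunLe.skip : RunLe (I := I) skip S S 1 := ⟨1, le_rfl, .skip⟩

theorem RunLe.push {k : Stk} {a : Alphabet I k} (h : update S k (a :: S k) = S') :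
    RunLe (push k a) S S' 1 := ⟨1, le_rfl, h ▸ .push⟩

theorem RunLe.pop {k : Stk} (h : update S k (S k).tail = S') : RunLe (pop k) S S' 1 :=
  ⟨1, le_rfl, h ▸ .pop⟩

section

variable {i : List I} {o : List Bool} {m a b c : List Tok} {s : Tok}

theorem push_main : RunLe (.push Stk.main s) (st i o m a b c) (st i o (s :: m) a b c) 1 :=
  .push (by funext k; cases k <;> rfl)
theorem push_aux : RunLe (.push Stk.aux s) (st i o m a b c) (st i o m (s :: a) b c) 1 :=
  .push (by funext k; cases k <;> rfl)
theorem push_tmp : RunLe (.push Stk.tmp s) (st i o m a b c) (st i o m a (s :: b) c) 1 :=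
  .push (by funext k; cases k <;> rfl)
theorem push_cnt : RunLe (.push Stk.cnt s) (st i o m a b c) (st i o m a b (s :: c)) 1 :=
  .push (by funext k; cases k <;> rfl)
theorem push_out {x : Bool} :
    RunLe (.push Stk.out x) (st i o m a b c) (st i (x :: o) m a b c) 1 :=
  .push (by funext k; cases k <;> rfl)
theorem pop_main : RunLe (.pop Stk.main) (st i o (s :: m) a b c) (st i o m a b c) 1 :=
  .pop (by funext k; cases k <;> rfl)
theorem pop_aux : RunLe (.pop Stk.aux) (st i o m (s :: a) b c) (st i o m a b c) 1 :=
  .pop (by funext k; cases k <;> rfl)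
theorem pop_tmp : RunLe (.pop Stk.tmp) (st i o m a (s :: b) c) (st i o m a b c) 1 :=
  .pop (by funext k; cases k <;> rfl)
theorem pop_cnt : RunLe (.pop Stk.cnt) (st i o m a b (s :: c)) (st i o m a b c) 1 :=
  .pop (by funext k; cases k <;> rfl)
theorem pop_inp {x : I} : RunLe (.pop Stk.inp) (st (x :: i) o m a b c) (st i o m a b c) 1 :=
  .pop (by funext k; cases k <;> rfl)

end

theorem RunLe.ite_true {k : Stk} {p : Option (Alphabet I k) → Bool} (hp : p (S k).head? = true)
    (h : RunLe P S S' n) : RunLe (ite k p P Q) S S' (n + 1) :=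
  let ⟨t, ht, hr⟩ := h
  ⟨t + 1, Nat.add_le_add_right ht 1, .ite_true hp hr⟩

theorem RunLe.ite_false {k : Stk} {p : Option (Alphabet I k) → Bool} (hp : p (S k).head? = false)
    (h : RunLe Q S S' n) : RunLe (ite k p P Q) S S' (n + 1) :=
  let ⟨t, ht, hr⟩ := h
  ⟨t + 1, Nat.add_le_add_right ht 1, .ite_false hp hr⟩

theorem RunLe.loop_false {k : Stk} {p : Option (Alphabet I k) → Bool}
    (hp : p (S k).head? = false) : RunLe (loop k p P) S S 1 := ⟨1, le_rfl, .loop_false hp⟩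

theorem RunLe.loop_true {k : Stk} {p : Option (Alphabet I k) → Bool} (hp : p (S k).head? = true)
    (h : RunLe P S S' m) (h' : RunLe (loop k p P) S' S'' n) :
    RunLe (loop k p P) S S'' (m + n + 1) :=
  let ⟨t, ht, hr⟩ := h
  let ⟨t', ht', hr'⟩ := h'
  ⟨t + t' + 1, by omega, .loop_true hp hr hr'⟩

/-! ### Moving trees between stacks -/

/-- Is the topmost symbol a leaf? -/
def isLeaf : Option Tok → Bool
  | some .leaf => true
  | _ => false

/-- Is the topmost symbol a node? -/
def isNode : Option Tok → Bool
  | some .node => true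
  | _ => false

/-- Is the topmost symbol a leaf or a node? -/
def isTree : Option Tok → Bool
  | some .leaf => true
  | some .node => true
  | _ => false

/-- The loop of `unload`: as long as the counter is positive, move a symbol. -/
def unloadLoop : Prog (Alphabet I) :=
  loop Stk.cnt isLeaf (ite Stk.main isLeaf
    (seq (pop Stk.main) (seq (push Stk.aux Tok.leaf) (pop Stk.cnt)))
    (seq (pop Stk.main) (seq (push Stk.aux Tok.node) (push Stk.cnt Tok.leaf))))

/-- Move the topmost tree from the main stack to the auxiliary stack, where it ends up reversed, on
top of a mark. -/
def unload : Prog (Alphabet I) :=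
  seq (push Stk.aux Tok.mark) (seq (push Stk.cnt Tok.leaf) unloadLoop)

/-- The counter holds the number of subtrees still to be read: a leaf completes one, a node replaces
one by two. The rest of the run is a hypothesis, so that the induction can treat the two subtrees of
a node one after the other within the same loop. -/
theorem runLe_unloadLoop {i : List I} {o : List Bool} {b : List Tok} (v : Val) :
    ∀ {r a c n}, RunLe unloadLoop (st i o r (v.code.reverse ++ a) b c) S' n →
      RunLe unloadLoop (st i o (v.code ++ r) a b (Tok.leaf :: c)) S' (5 * v.size + n) := by
  induction v with
  | leaf =>
    intro r a c n h
    refine (RunLe.loop_true (S := st i o (Tok.leaf :: r) a b (Tok.leaf :: c)) rfl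
      (.ite_true rfl (.seq pop_main (.seq push_aux pop_cnt))) h).mono ?_
    simp only [Val.size]; omega
  | node u v ihu ihv =>
    intro r a c n h
    have h' : RunLe unloadLoop (st i o (u.code ++ (v.code ++ r)) (Tok.node :: a) b
        (Tok.leaf :: Tok.leaf :: c)) S' (5 * u.size + (5 * v.size + n)) := by
      refine ihu (ihv ?_)
      simpa [Val.code] using h
    have h'' := RunLe.loop_true
      (S := st i o (Tok.node :: (u.code ++ (v.code ++ r))) a b (Tok.leaf :: c)) rfl
      (.ite_false rfl (.seq pop_main (.seq push_aux push_cnt))) h'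
    refine RunLe.mono (by simpa [Val.code, unloadLoop] using h'') ?_
    simp only [Val.size]; omega

theorem runLe_unload {i : List I} {o : List Bool} {r a b : List Tok} (v : Val) :
    RunLe unload (st i o (v.code ++ r) a b []) (st i o r (v.code.reverse ++ Tok.mark :: a) b [])
      (5 * v.size + 3) :=
  (RunLe.seq push_aux (.seq push_cnt (runLe_unloadLoop v (.loop_false rfl)))).mono (by omega)

/-- Pop everything down to the first mark from the auxiliary stack, with the program `P s` for every
symbol `s`. -/
def drainAux (P : Tok → Prog (Alphabet I)) : Prog (Alphabet I) :=
  seq (loop Stk.aux isTree (ite Stk.aux isLeaf (seq (pop Stk.aux) (P .leaf))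
    (seq (pop Stk.aux) (P .node)))) (pop Stk.aux)

/-- Move everything down to the first mark from the temporary to the auxiliary stack. -/
def drainTmp : Prog (Alphabet I) :=
  seq (loop Stk.tmp isTree (ite Stk.tmp isLeaf (seq (pop Stk.tmp) (push Stk.aux Tok.leaf))
    (seq (pop Stk.tmp) (push Stk.aux Tok.node)))) (pop Stk.tmp)

/-- `M` and `B` give the main and temporary stacks as functions of the symbols drained so far, so
that dropping, copying and moving are all instances. -/
theorem runLe_drainAux {P : Tok → Prog (Alphabet I)} {i : List I} {o : List Bool} {a : List Tok}
    (M B : List Tok → List Tok) {d : ℕ}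
    (hP : ∀ s l acc, RunLe (P s) (st i o (M acc) l (B acc) [])
      (st i o (M (s :: acc)) l (B (s :: acc)) []) d) (l : List Tok) (hl : Tok.mark ∉ l) :
    RunLe (drainAux P) (st i o (M []) (l ++ Tok.mark :: a) (B []) [])
      (st i o (M l.reverse) a (B l.reverse) []) ((d + 3) * l.length + 2) := by
  -- The symbols already drained must be arbitrary for the induction.
  suffices h : ∀ acc, RunLe (drainAux P) (st i o (M acc) (l ++ Tok.mark :: a) (B acc) [])
      (st i o (M (l.reverse ++ acc)) a (B (l.reverse ++ acc)) []) ((d + 3) * l.length + 2) by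
    simpa using h []
  unfold drainAux
  refine fun acc => RunLe.mono (.seq (m := (d + 3) * l.length + 1) ?_ (pop_aux (s := .mark))) (by omega)
  induction l generalizing acc with
  | nil => simpa using RunLe.loop_false rfl
  | cons s l ih =>
    have hs : s = .leaf ∨ s = .node := by cases s <;> simp_all
    have h := ih (by simp_all) (s :: acc)
    rcases hs with rfl | rfl
    · have := RunLe.loop_true (S := st i o (M acc) (Tok.leaf :: (l ++ Tok.mark :: a)) (B acc) []) rfl
        (.ite_true rfl (.seq pop_aux (hP ..))) h
      exact RunLe.mono (by simpa using this) (by simp only [List.length_cons]; ring_nf; omega)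
    · have := RunLe.loop_true (S := st i o (M acc) (Tok.node :: (l ++ Tok.mark :: a)) (B acc) []) rfl
        (.ite_false rfl (.seq pop_aux (hP ..))) h
      exact RunLe.mono (by simpa using this) (by simp only [List.length_cons]; ring_nf; omega)

theorem runLe_drainTmp {i : List I} {o : List Bool} {m b : List Tok} (l : List Tok)
    (hl : Tok.mark ∉ l) (a : List Tok) :
    RunLe drainTmp (st i o m a (l ++ Tok.mark :: b) []) (st i o m (l.reverse ++ a) b [])
      (4 * l.length + 2) := by
  unfold drainTmp
  refine RunLe.mono (.seq (m := 4 * l.length + 1) ?_ (pop_tmp (s := .mark))) (by omega)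
  induction l generalizing a with
  | nil => simpa using RunLe.loop_false rfl
  | cons s l ih =>
    have hs : s = .leaf ∨ s = .node := by cases s <;> simp_all
    have h := ih (by simp_all) (s :: a)
    rcases hs with rfl | rfl
    · have := RunLe.loop_true (S := st i o m a (Tok.leaf :: (l ++ Tok.mark :: b)) []) rfl
        (.ite_true rfl (.seq pop_tmp push_aux)) h
      exact RunLe.mono (by simpa using this) (by simp only [List.length_cons]; ring_nf; omega)
    · have := RunLe.loop_true (S := st i o m a (Tok.node :: (l ++ Tok.mark :: b)) []) rfl
        (.ite_false rfl (.seq pop_tmp push_aux)) h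
      exact RunLe.mono (by simpa using this) (by simp only [List.length_cons]; ring_nf; omega)

/-- Remove the topmost tree. -/
def drop : Prog (Alphabet I) := seq unload (drainAux fun _ => skip)

/-- Duplicate the topmost tree. -/
def dup : Prog (Alphabet I) :=
  seq unload (seq (push Stk.tmp Tok.mark)
    (seq (drainAux fun s => seq (push Stk.main s) (push Stk.tmp s))
    (seq (push Stk.aux Tok.mark) (seq drainTmp (drainAux fun s => push Stk.main s)))))

/-- Exchange the two topmost trees. -/
def swap : Prog (Alphabet I) :=
  seq unload (seq unload (seq (push Stk.tmp Tok.mark) (seq (drainAux fun s => push Stk.tmp s)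
    (seq (drainAux fun s => push Stk.main s) (seq (push Stk.aux Tok.mark)
      (seq drainTmp (drainAux fun s => push Stk.main s)))))))

variable {i : List I} {o : List Bool} {r a b : List Tok}

theorem runLe_drop (v : Val) :
    RunLe drop (st i o (v.code ++ r) a b []) (st i o r a b []) (9 * v.size + 5) := by
  refine RunLe.mono (.seq (runLe_unload v) (runLe_drainAux (fun _ => r) (fun _ => b)
    (fun _ _ _ => .skip) _ (by simpa using v.mark_notMem_code))) ?_
  simp only [List.length_reverse, Val.length_code]; omega

/-- Each transfer reverses the order of the symbols. After `unload` and one drain the tree is in the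
right order on both `main` and `tmp`; the second copy then takes two more transfers, through `aux`
to `main`. -/
theorem runLe_dup (v : Val) :
    RunLe dup (st i o (v.code ++ r) a b []) (st i o (v.code ++ (v.code ++ r)) a b [])
      (18 * v.size + 11) := by
  have hm := v.mark_notMem_code
  have hm' : Tok.mark ∉ v.code.reverse := by simpa using hm
  have h := runLe_drainAux (i := i) (o := o) (a := a) (P := fun s => seq (push Stk.main s)
    (push Stk.tmp s)) (· ++ r) (· ++ Tok.mark :: b) (fun _ _ _ => .seq push_main push_tmp) _ hm'
  have h' := runLe_drainAux (i := i) (o := o) (a := a) (P := fun s => push Stk.main s)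
    (· ++ (v.code ++ r)) (fun _ => b) (fun _ _ _ => push_main) _ hm'
  simp only [List.reverse_reverse, List.nil_append] at h h'
  refine RunLe.mono (.seq (runLe_unload v) (.seq push_tmp (.seq h (.seq push_aux (.seq
    (runLe_drainTmp _ hm _) h'))))) ?_
  simp only [List.length_reverse, Val.length_code]; omega

/-- Both trees lie reversed on `aux`, `v` on top. Parking `v` on `tmp` lets `u` return to `main`
first. -/
theorem runLe_swap (u v : Val) :
    RunLe swap (st i o (u.code ++ (v.code ++ r)) a b []) (st i o (v.code ++ (u.code ++ r)) a b [])
      (17 * (u.size + v.size) + 16) := by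
  have hu' : Tok.mark ∉ u.code.reverse := by simpa using u.mark_notMem_code
  have hv' : Tok.mark ∉ v.code.reverse := by simpa using v.mark_notMem_code
  have h := runLe_drainAux (i := i) (o := o) (a := u.code.reverse ++ Tok.mark :: a)
    (P := fun s => push Stk.tmp s) (fun _ => r) (· ++ Tok.mark :: b) (fun _ _ _ => push_tmp) _ hv'
  have h' := runLe_drainAux (i := i) (o := o) (a := a) (P := fun s => push Stk.main s)
    (· ++ r) (fun _ => v.code ++ Tok.mark :: b) (fun _ _ _ => push_main) _ hu'
  have h'' := runLe_drainAux (i := i) (o := o) (a := a) (P := fun s => push Stk.main s)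
    (· ++ (u.code ++ r)) (fun _ => b) (fun _ _ _ => push_main) _ hv'
  simp only [List.reverse_reverse, List.nil_append] at h h' h''
  refine RunLe.mono (.seq (runLe_unload u) (.seq (runLe_unload v) (.seq push_tmp (.seq h (.seq h'
    (.seq push_aux (.seq (runLe_drainTmp _ v.mark_notMem_code _) h''))))))) ?_
  simp only [List.length_reverse, Val.length_code]; omega

end Prog

open Prog

/-- Coefficients in `ℕ` make polynomials monotone, so size bounds can be inserted into time bounds.
-/
theorem eval_mono (p : Polynomial ℕ) {m n : ℕ} (h : m ≤ n) : p.eval m ≤ p.eval n := by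
  rw [Polynomial.eval_eq_sum_range, Polynomial.eval_eq_sum_range]
  gcongr

/-! ### Encodings by trees -/

/-- An encoding of the elements of a type by trees. -/
class Enc (α : Type) where
  enc : α → Val

/-- The size of the encoding. -/
def size {α : Type} [Enc α] (x : α) : ℕ := (Enc.enc x).size

/-- The encoding of lists. -/
def encValList {α : Type} [Enc α] : List α → Val
  | [] => .leaf
  | a :: l => .node (Enc.enc a) (encValList l)

instance : Enc Unit := ⟨fun _ => .leaf⟩
instance : Enc Bool := ⟨fun b => cond b (.node .leaf .leaf) .leaf⟩
instance {α β : Type} [Enc α] [Enc β] : Enc (α × β) := ⟨fun p => .node (Enc.enc p.1) (Enc.enc p.2)⟩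
instance {α : Type} [Enc α] : Enc (List α) := ⟨encValList⟩

section

variable {α β γ δ σ : Type} [Enc α] [Enc β] [Enc γ] [Enc δ] [Enc σ]

theorem size_pair (a : α) (b : β) : size (a, b) = size a + size b + 1 := rfl
theorem size_nil : size ([] : List α) = 1 := rfl
theorem size_cons (a : α) (l : List α) : size (a :: l) = size a + size l + 1 := rfl
theorem size_append (l l' : List α) : size (l ++ l') + 1 = size l + size l' := by
  induction l with
  | nil => rw [List.nil_append, size_nil, Nat.add_comm]
  | cons a l ih => rw [List.cons_append, size_cons, size_cons]; omega
theorem size_pos (a : α) : 0 < size a := Val.size_pos _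
theorem length_lt_size (l : List α) : l.length < size l := by
  induction l with
  | nil => simp [size_nil]
  | cons a l ih => rw [List.length_cons, size_cons]; omega
theorem size_le_of_mem {a : α} {l : List α} (h : a ∈ l) : size a < size l := by
  induction l with
  | nil => simp at h
  | cons b l ih =>
    rw [size_cons]
    rcases List.mem_cons.1 h with rfl | h
    · omega
    · have := ih h; omega
theorem size_bool_le (b : Bool) : size b ≤ 3 := by cases b <;> simp [size, Enc.enc, Val.size]

end

/-! ### Functions computable in polynomial time -/

variable (I : Type)

/-- The program `P` computes `f` in time `T`, applied to the size of the argument. -/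
def Computes {α β : Type} [Enc α] [Enc β] (P : Prog (Alphabet I)) (f : α → β) (T : ℕ → ℕ) : Prop :=
  ∀ (x : α) (i : List I) (o : List Bool) (r a b : List Tok),
    RunLe P (st i o ((Enc.enc x).code ++ r) a b []) (st i o ((Enc.enc (f x)).code ++ r) a b [])
      (T (size x))

/-- Functions that are computable in polynomial time. -/
def PolyTime {α β : Type} [Enc α] [Enc β] (f : α → β) : Prop :=
  ∃ (P : Prog (Alphabet I)) (p : Polynomial ℕ), Computes I P f p.eval ∧
    ∀ x, size (f x) ≤ p.eval (size x)

namespace PolyTime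

variable {I} {α β γ δ σ : Type} [Enc α] [Enc β] [Enc γ] [Enc δ] [Enc σ]

/-- A program sees only codes. Hence types whose elements have equal codes can be interchanged, such
as nonempty lists and pairs of head and tail, or Booleans and lists `[()]`, `[]`. -/
theorem of_enc_eq {α' β' : Type} [Enc α'] [Enc β'] {f : α → β} (hf : PolyTime I f) {g : α' → β'}
    (e : α' → α) (he : ∀ x, Enc.enc (e x) = Enc.enc x)
    (h : ∀ x, Enc.enc (g x) = Enc.enc (f (e x))) : PolyTime I g := by
  obtain ⟨P, p, hP, hp⟩ := hf
  refine ⟨P, p, fun x i o r a b => ?_, fun x => ?_⟩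
  · have := hP (e x) i o r a b
    rwa [he, ← h, size, he] at this
  · have := hp (e x)
    rwa [size, size, he, ← h] at this

theorem id : PolyTime I (fun x : α => x) := by
  refine ⟨.skip, .X + 1, fun x i o r a b => RunLe.skip.mono ?_, fun x => ?_⟩ <;> simp

/-- The output size bound in `PolyTime` is needed here: the second program runs on `f x`, whose size
must be polynomial in that of `x`. -/
theorem comp {g : β → γ} {f : α → β} (hg : PolyTime I g) (hf : PolyTime I f) :
    PolyTime I (fun x => g (f x)) := by
  obtain ⟨P, p, hP, hp⟩ := hf
  obtain ⟨Q, q, hQ, hq⟩ := hg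
  refine ⟨.seq P Q, p + q.comp p, fun x i o r a b => ?_, fun x => ?_⟩
  · refine ((hP x i o r a b).seq (hQ (f x) i o r a b)).mono ?_
    simpa using eval_mono q (hp x)
  · have := (hq (f x)).trans (eval_mono q (hp x))
    simp only [Polynomial.eval_add, Polynomial.eval_comp]
    omega

theorem pair {f : α → β} {g : α → γ} (hf : PolyTime I f) (hg : PolyTime I g) :
    PolyTime I (fun x => (f x, g x)) := by
  obtain ⟨P, p, hP, hp⟩ := hf
  obtain ⟨Q, q, hQ, hq⟩ := hg
  refine ⟨.seq dup (.seq P (.seq swap (.seq Q (.seq swap (.push Stk.main .node))))),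
    18 * .X + 11 + (p + (17 * (p + .X) + 16 + (q + (17 * (q + p) + 16 + 1)))),
    fun x i o r a b => ?_, fun x => ?_⟩
  · have h1 := runLe_dup (i := i) (o := o) (r := r) (a := a) (b := b) (Enc.enc x)
    have h2 := hP x i o ((Enc.enc x).code ++ r) a b
    have h3 := runLe_swap (i := i) (o := o) (r := r) (a := a) (b := b) (Enc.enc (f x)) (Enc.enc x)
    have h4 := hQ x i o ((Enc.enc (f x)).code ++ r) a b
    have h5 := runLe_swap (i := i) (o := o) (r := r) (a := a) (b := b) (Enc.enc (g x))
      (Enc.enc (f x))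
    have h6 := push_main (i := i) (o := o) (a := a) (b := b) (c := []) (s := .node)
      (m := (Enc.enc (f x)).code ++ ((Enc.enc (g x)).code ++ r))
    have h := h1.seq (h2.seq (h3.seq (h4.seq (h5.seq h6))))
    have hp := hp x
    have hq := hq x
    refine RunLe.mono (by simpa [Enc.enc, Val.code] using h) ?_
    simp only [Polynomial.eval_add, Polynomial.eval_mul, Polynomial.eval_X,
      Polynomial.eval_ofNat, Polynomial.eval_one]
    change size _ ≤ _ at hp hq
    simp only [size] at *
    omega
  · have hp := hp x
    have hq := hq x
    simp only [Polynomial.eval_add, Polynomial.eval_mul, Polynomial.eval_X,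
      Polynomial.eval_ofNat, Polynomial.eval_one, size_pair]
    omega

theorem fst : PolyTime I (fun x : α × β => x.1) := by
  refine ⟨.seq (.pop Stk.main) (.seq swap drop), 40 * .X + 40, fun x i o r a b => ?_, fun x => ?_⟩
  · have h := (pop_main (i := i) (o := o) (a := a) (b := b) (c := []) (s := .node)).seq
      ((runLe_swap (i := i) (o := o) (r := r) (a := a) (b := b) (Enc.enc x.1) (Enc.enc x.2)).seq
      (runLe_drop _))
    refine RunLe.mono (by simpa [Enc.enc, Val.code] using h) ?_
    have : size x = size x.1 + size x.2 + 1 := rfl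
    simp only [size, Polynomial.eval_add, Polynomial.eval_mul, Polynomial.eval_X,
      Polynomial.eval_ofNat] at *
    omega
  · have : size x = size x.1 + size x.2 + 1 := rfl
    simp only [Polynomial.eval_add, Polynomial.eval_mul, Polynomial.eval_X,
      Polynomial.eval_ofNat] at *
    omega

theorem snd : PolyTime I (fun x : α × β => x.2) := by
  refine ⟨.seq (.pop Stk.main) drop, 40 * .X + 40, fun x i o r a b => ?_, fun x => ?_⟩
  · have h := (pop_main (i := i) (o := o) (a := a) (b := b) (c := []) (s := .node)).seq
      (runLe_drop (i := i) (o := o) (r := (Enc.enc x.2).code ++ r) (a := a) (b := b) (Enc.enc x.1))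
    refine RunLe.mono (by simpa [Enc.enc, Val.code] using h) ?_
    have : size x = size x.1 + size x.2 + 1 := rfl
    simp only [size, Polynomial.eval_add, Polynomial.eval_mul, Polynomial.eval_X,
      Polynomial.eval_ofNat] at *
    omega
  · have : size x = size x.1 + size x.2 + 1 := rfl
    simp only [Polynomial.eval_add, Polynomial.eval_mul, Polynomial.eval_X,
      Polynomial.eval_ofNat] at *
    omega

/-- Push the Polish notation of a tree. -/
theorem exists_runLe_build (v : Val) : ∃ (P : Prog (Alphabet I)) (n : ℕ), ∀ i o r a b,
    RunLe P (st i o r a b []) (st i o (v.code ++ r) a b []) n := by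
  induction v with
  | leaf => exact ⟨.push Stk.main .leaf, 1, fun i o r a b => push_main⟩
  | node u v ihu ihv =>
    obtain ⟨P, m, hP⟩ := ihu
    obtain ⟨Q, n, hQ⟩ := ihv
    refine ⟨.seq Q (.seq P (.push Stk.main .node)), n + (m + 1), fun i o r a b =>
      ((hQ i o r a b).seq ((hP i o (v.code ++ r) a b).seq ?_))⟩
    simpa [Val.code] using push_main (i := i) (o := o) (a := a) (b := b) (c := []) (s := .node)
        (m := u.code ++ (v.code ++ r))

theorem const (y : β) : PolyTime I (fun _ : α => y) := by
  obtain ⟨P, n, hP⟩ := exists_runLe_build (I := I) (Enc.enc y)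
  refine ⟨.seq drop P, 9 * .X + 5 + .C n + .C (size y), fun x i o r a b => ?_, fun x => ?_⟩
  · refine ((runLe_drop _).seq (hP i o r a b)).mono ?_
    simp [size]
  · simp

/-- Case distinction on lists. -/
theorem list_cases {l : α → List β} {f : α → γ} {g : α → β × List β → γ} (hl : PolyTime I l)
    (hf : PolyTime I f) (hg : PolyTime I (fun x : α × (β × List β) => g x.1 x.2)) :
    PolyTime I (fun x => match l x with | [] => f x | b :: t => g x (b, t)) := by
  obtain ⟨P, p, hP, hp⟩ := (id (I := I) (α := α)).pair hl
  obtain ⟨Q, q, hQ, hq⟩ := hf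
  obtain ⟨R, r, hR, hr⟩ := hg
  -- The code of `(x, l x)` is split and `l x` brought to the top, where its first symbol tells
  -- whether it is empty. As `y :: t` and `(y, t)` have the same code, swapping back and pushing a
  -- node yields the argument `(x, (y, t))` of `R`.
  refine ⟨.seq P (.seq (.pop Stk.main) (.seq swap (.ite Stk.main isLeaf
    (.seq (.pop Stk.main) Q) (.seq swap (.seq (.push Stk.main .node) R))))),
    p + 1 + (17 * p + 16) + (1 + (q + 1) + ((17 * p + 16) + (1 + (r.comp p + 1)))),
    fun x i o s a b => ?_, fun x => ?_⟩
  · have h1 := hP x i o s a b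
    have h2 := pop_main (i := i) (o := o) (a := a) (b := b) (c := []) (s := .node)
      (m := (Enc.enc x).code ++ ((Enc.enc (l x)).code ++ s))
    have h3 := runLe_swap (i := i) (o := o) (r := s) (a := a) (b := b) (Enc.enc x) (Enc.enc (l x))
    have hx := hp x
    rw [size_pair] at hx
    dsimp only at h1 ⊢
    rcases hlx : l x with _ | ⟨y, t⟩
    · rw [hlx] at h1 h2 h3 hx
      have h4 := RunLe.ite_true (k := Stk.main) (p := isLeaf) (Q := (.seq swap (.seq (.push Stk.main .node) R)))
        (S := st i o (Tok.leaf :: ((Enc.enc x).code ++ s)) a b []) rfl (pop_main.seq (hQ x i o s a b))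
      refine RunLe.mono (h1.seq (RunLe.seq (by simpa [Enc.enc, Val.code] using h2)
        (h3.seq (by simpa [Enc.enc, Val.code, encValList] using h4)))) ?_
      simp only [size, Polynomial.eval_add, Polynomial.eval_mul,
        Polynomial.eval_ofNat, Polynomial.eval_one] at *
      omega
    · rw [hlx] at h1 h2 h3 hx
      have h5 := runLe_swap (i := i) (o := o) (r := s) (a := a) (b := b) (Enc.enc (y :: t))
        (Enc.enc x)
      have h6 := push_main (i := i) (o := o) (a := a) (b := b) (c := []) (s := .node)
        (m := (Enc.enc x).code ++ ((Enc.enc (y :: t)).code ++ s))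
      have h7 := hR (x, (y, t)) i o s a b
      have h4 := RunLe.ite_false (k := Stk.main) (p := isLeaf) (P := (.seq (.pop Stk.main) Q))
        (S := st i o ((Enc.enc (y :: t)).code ++ ((Enc.enc x).code ++ s)) a b []) rfl
        (h5.seq (h6.seq (by simpa [Enc.enc, Val.code, encValList] using h7)))
      refine RunLe.mono (h1.seq (RunLe.seq (by simpa [Enc.enc, Val.code] using h2)
        (h3.seq (by simpa [Enc.enc, Val.code, encValList] using h4)))) ?_
      have h8 : size (x, (y, t)) ≤ p.eval (size x) := hx
      have h9 := eval_mono r h8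
      simp only [size, Polynomial.eval_add, Polynomial.eval_mul, Polynomial.eval_comp,
        Polynomial.eval_ofNat, Polynomial.eval_one] at *
      have h10 : (Enc.enc (y :: t)).size = ((Enc.enc y).node (encValList t)).size := rfl
      omega
  · have hx := hp x
    rw [size_pair] at hx
    simp only [Polynomial.eval_add, Polynomial.eval_mul, Polynomial.eval_comp,
        Polynomial.eval_ofNat, Polynomial.eval_one] at *
    rcases hlx : l x with _ | ⟨y, t⟩
    · have := hq x
      simp only
      omega
    · rw [hlx] at hx
      have h8 : size (x, (y, t)) ≤ p.eval (size x) := hx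
      have h9 := eval_mono r h8
      have := hr (x, (y, t))
      simp only at *
      omega

end PolyTime

namespace PolyTime

variable {I : Type} {α β γ δ σ : Type} [Enc α] [Enc β] [Enc γ] [Enc δ] [Enc σ]

theorem comp₂ {g : β × γ → δ} (hg : PolyTime I g) {f : α → β} {f' : α → γ} (hf : PolyTime I f)
    (hf' : PolyTime I f') : PolyTime I (fun x => g (f x, f' x)) := hg.comp (hf.pair hf')

theorem cons {f : α → β} {g : α → List β} (hf : PolyTime I f) (hg : PolyTime I g) :
    PolyTime I (fun x => f x :: g x) :=
  (hf.pair hg).of_enc_eq _ (fun _ => rfl) fun _ => rfl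

/-! ### Folds over lists -/

/-- The loop of a fold. -/
theorem runLe_fold {g : γ × (σ × α) → σ} {R : Prog (Alphabet I)} {p : Polynomial ℕ}
    (hR : Computes I R (fun x : (α × List α) × (γ × σ) =>
      (x.1.2, (x.2.1, g (x.2.1, (x.2.2, x.1.1))))) p.eval) (c : γ) (N : ℕ)
    (i : List I) (o : List Bool) (r a b : List Tok) (l : List α) :
    ∀ s : σ, (∀ l' : List α, l' <+: l →
        size l + size c + size (l'.foldl (fun s a => g (c, (s, a))) s) + 2 ≤ N) →
      RunLe (.loop Stk.main isNode (.seq (.push Stk.main .node) (.seq R (.pop Stk.main))))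
        (st i o ((Enc.enc l).code ++ ((Enc.enc (c, s)).code ++ r)) a b [])
        (st i o ((Enc.enc ([] : List α)).code ++
          ((Enc.enc (c, l.foldl (fun s a => g (c, (s, a))) s)).code ++ r)) a b [])
        ((p.eval N + 3) * l.length + 1) := by
  induction l with
  | nil => exact fun s _ => .loop_false rfl
  | cons y l ih =>
    intro s hs
    -- The node joins the list `y :: l`, read as the pair `(y, l)`, with `(c, s)` into one argument
    -- of `R`; popping the node of the result separates the remaining list from the new state.
    have h1 := push_main (i := i) (o := o) (a := a) (b := b) (c := []) (s := .node)
      (m := ((Enc.enc (y :: l)).code ++ ((Enc.enc (c, s)).code ++ r)))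
    have h2 := hR ((y, l), (c, s)) i o r a b
    have h3 := pop_main (i := i) (o := o) (a := a) (b := b) (c := []) (s := .node)
      (m := ((Enc.enc l).code ++ ((Enc.enc (c, g (c, (s, y)))).code ++ r)))
    have h4 := ih (g (c, (s, y))) fun l' hl' => by
      have := hs (y :: l') (by simpa using hl')
      rw [size_cons, List.foldl_cons] at this
      omega
    have h5 : size ((y, l), (c, s)) ≤ N := by
      have := hs [] (List.nil_prefix)
      rw [size_cons, List.foldl_nil] at this
      rw [size_pair, size_pair, size_pair]
      omega
    have h6 := eval_mono p h5
    have h := RunLe.loop_true (k := Stk.main) (p := isNode)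
      (S := st i o ((Enc.enc (y :: l)).code ++ ((Enc.enc (c, s)).code ++ r)) a b []) rfl
      (h1.seq (RunLe.seq (by simpa [Enc.enc, Val.code, encValList] using h2)
        (by simpa [Enc.enc, Val.code] using h3))) h4
    refine RunLe.mono h ?_
    have h7 : (p.eval N + 3) * (l.length + 1) = (p.eval N + 3) * l.length + (p.eval N + 3) := by
      ring
    simp only [List.length_cons]
    omega

/-- A polynomial time step alone would allow the state to grow exponentially, so all intermediate
states, i.e. the folds over prefixes, are required to be polynomially bounded. -/
theorem foldl {l : γ → List α} {s : γ → σ} {g : γ × (σ × α) → σ} (hl : PolyTime I l)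
    (hs : PolyTime I s) (hg : PolyTime I g) (B : Polynomial ℕ)
    (hB : ∀ x, ∀ l' : List α, l' <+: l x →
      size (l'.foldl (fun s a => g (x, (s, a))) (s x)) ≤ B.eval (size x)) :
    PolyTime I (fun x => (l x).foldl (fun s a => g (x, (s, a))) (s x)) := by
  have h1 : PolyTime I (fun x => (l x, (x, s x))) := hl.pair (id.pair hs)
  have h2 : PolyTime I (fun x : (α × List α) × (γ × σ) =>
      (x.1.2, (x.2.1, g (x.2.1, (x.2.2, x.1.1))))) :=
    (snd.comp fst).pair ((fst.comp snd).pair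
      (hg.comp ((fst.comp snd).pair ((snd.comp snd).pair (fst.comp fst)))))
  suffices h : PolyTime I (fun x => (x, (l x).foldl (fun s a => g (x, (s, a))) (s x))) from
    snd.comp h
  obtain ⟨P, p, hP, hp⟩ := h1
  obtain ⟨R, r, hR, -⟩ := h2
  refine ⟨.seq P (.seq (.pop Stk.main) (.seq (.loop Stk.main isNode
    (.seq (.push Stk.main .node) (.seq R (.pop Stk.main)))) (.pop Stk.main))),
    p + (1 + (((r.comp (p + .X + B + 2) + 3) * p + 1) + 1)) + .X + B,
    fun x i o t a b => ?_, fun x => ?_⟩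
  · have h1 := hP x i o t a b
    have h2 := pop_main (i := i) (o := o) (a := a) (b := b) (c := []) (s := .node)
      (m := (Enc.enc (l x)).code ++ ((Enc.enc (x, s x)).code ++ t))
    have hx := hp x
    rw [size_pair] at hx
    have h3 := runLe_fold hR x (p.eval (size x) + size x + B.eval (size x) + 2) i o t a b (l x)
      (s x) fun l' hl' => by
        have := hB x l' hl'
        omega
    have h4 := pop_main (i := i) (o := o) (a := a) (b := b) (c := []) (s := .leaf)
      (m := (Enc.enc (x, (l x).foldl (fun s a => g (x, (s, a))) (s x))).code ++ t)
    have hlen := length_lt_size (l x)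
    have hle := Nat.mul_le_mul_left
      (r.eval (p.eval (size x) + size x + B.eval (size x) + 2) + 3)
      (show (l x).length ≤ p.eval (size x) by omega)
    refine RunLe.mono (h1.seq (RunLe.seq (by simpa [Enc.enc, Val.code] using h2)
      (h3.seq (by simpa [Enc.enc, Val.code, encValList] using h4)))) ?_
    simp only [Polynomial.eval_add, Polynomial.eval_mul, Polynomial.eval_comp, Polynomial.eval_X,
        Polynomial.eval_ofNat, Polynomial.eval_one] at *
    omega
  · have := hB x (l x) List.prefix_rfl
    simp only [Polynomial.eval_add, Polynomial.eval_mul, Polynomial.eval_comp, Polynomial.eval_X,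
        Polynomial.eval_ofNat, Polynomial.eval_one, size_pair]
    omega

/-- A fold whose state grows, in every step, by an amount that does not depend on the state. -/
theorem foldl_of_size_le {l : γ → List α} {s : γ → σ} {g : γ × (σ × α) → σ} (hl : PolyTime I l)
    (hs : PolyTime I s) (hg : PolyTime I g) (B : Polynomial ℕ)
    (hB : ∀ x s a, a ∈ l x → size (g (x, (s, a))) ≤ size s + B.eval (size x)) :
    PolyTime I (fun x => (l x).foldl (fun s a => g (x, (s, a))) (s x)) := by
  obtain ⟨p, hp⟩ : ∃ p : Polynomial ℕ, ∀ x, size (l x) ≤ p.eval (size x) :=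
    let ⟨_, p, _, hp⟩ := hl; ⟨p, hp⟩
  obtain ⟨q, hq⟩ : ∃ q : Polynomial ℕ, ∀ x, size (s x) ≤ q.eval (size x) :=
    let ⟨_, q, _, hq⟩ := hs; ⟨q, hq⟩
  -- Initial size, plus the number of steps times the growth per step.
  refine foldl hl hs hg (q + p * B) fun x l' hl' => ?_
  have key : ∀ l'' : List α, (∀ a ∈ l'', a ∈ l x) → ∀ s, size (l''.foldl (fun s a => g (x, (s, a))) s)
      ≤ size s + l''.length * B.eval (size x) := by
    intro l''
    induction l'' with
    | nil => simp
    | cons a l'' ih =>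
      intro h s
      have h1 := hB x s a (h a (by simp))
      have h2 := ih (fun b hb => h b (by simp [hb])) (g (x, (s, a)))
      rw [List.foldl_cons, List.length_cons, Nat.add_mul]
      omega
  have h1 := key l' (fun a ha => hl'.subset ha) (s x)
  have h2 := hq x
  have h3 : l'.length ≤ p.eval (size x) :=
    (hl'.length_le.trans (length_lt_size (l x)).le).trans (hp x)
  have h4 := Nat.mul_le_mul_right (B.eval (size x)) h3
  simp only [Polynomial.eval_add, Polynomial.eval_mul]
  omega

/-! ### Booleans -/

theorem cond {c : α → Bool} {f g : α → β} (hc : PolyTime I c) (hf : PolyTime I f)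
    (hg : PolyTime I g) : PolyTime I (fun x => if c x then f x else g x) := by
  -- `true` and `false` have the codes of `[()]` and `[]`, so this is a case distinction on lists.
  have hc' : PolyTime I (fun x => if c x then [()] else []) :=
    hc.of_enc_eq (fun x => x) (fun _ => rfl) fun x => by cases c x <;> rfl
  have := hc'.list_cases hg (g := fun x _ => f x) (hf.comp fst)
  refine this.of_enc_eq (fun x => x) (fun _ => rfl) fun x => ?_
  cases c x <;> rfl

theorem not {f : α → Bool} (hf : PolyTime I f) : PolyTime I (fun x => !f x) := by
  refine (hf.cond (const false) (const true)).of_enc_eq (fun x => x) (fun _ => rfl) fun x => ?_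
  cases f x <;> rfl

theorem and {f g : α → Bool} (hf : PolyTime I f) (hg : PolyTime I g) :
    PolyTime I (fun x => f x && g x) := by
  refine (hf.cond hg (const false)).of_enc_eq (fun x => x) (fun _ => rfl) fun x => ?_
  cases f x <;> rfl

theorem or {f g : α → Bool} (hf : PolyTime I f) (hg : PolyTime I g) :
    PolyTime I (fun x => f x || g x) := by
  refine (hf.cond (const true) hg).of_enc_eq (fun x => x) (fun _ => rfl) fun x => ?_
  cases f x <;> rfl

theorem isEmpty {l : α → List β} (hl : PolyTime I l) : PolyTime I (fun x => (l x).isEmpty) := by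
  have := hl.list_cases (const true) (g := fun _ _ => false) (const false)
  refine this.of_enc_eq (fun x => x) (fun _ => rfl) fun x => ?_
  cases l x <;> rfl

/-! ### Lists -/

theorem tail {l : α → List β} (hl : PolyTime I l) : PolyTime I (fun x => (l x).tail) := by
  have := hl.list_cases (const []) (g := fun _ p => p.2) (snd.comp snd)
  refine this.of_enc_eq (fun x => x) (fun _ => rfl) fun x => ?_
  cases l x <;> rfl

theorem headD {l : α → List β} (hl : PolyTime I l) (b : β) :
    PolyTime I (fun x => (l x).headD b) := by
  have := hl.list_cases (const b) (g := fun _ p => p.1) (fst.comp snd)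
  refine this.of_enc_eq (fun x => x) (fun _ => rfl) fun x => ?_
  cases l x <;> rfl

theorem reverse {l : α → List β} (hl : PolyTime I l) : PolyTime I (fun x => (l x).reverse) := by
  obtain ⟨p, hp⟩ : ∃ p : Polynomial ℕ, ∀ x, size (l x) ≤ p.eval (size x) :=
    let ⟨_, p, _, hp⟩ := hl; ⟨p, hp⟩
  have := hl.foldl_of_size_le (const ([] : List β))
    (g := fun x : α × (List β × β) => x.2.2 :: x.2.1) (cons (snd.comp snd) (fst.comp snd)) (p + 1) fun x s a ha => by
      have := hp x
      have := size_le_of_mem ha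
      simp only [size_cons, Polynomial.eval_add, Polynomial.eval_one]
      omega
  refine this.of_enc_eq (fun x => x) (fun _ => rfl) fun x => ?_
  simp [List.foldl_flip_cons_eq_append]

/-- A left fold that conses reverses its results, so it is run on the reversed list; the same device
serves `filter` and `append`. -/
theorem map {l : α → List β} (hl : PolyTime I l) {f : α → β → γ}
    (hf : PolyTime I (fun x : α × β => f x.1 x.2)) : PolyTime I (fun x => (l x).map (f x)) := by
  obtain ⟨p, hp⟩ : ∃ p : Polynomial ℕ, ∀ x, size (l x) ≤ p.eval (size x) :=
    let ⟨_, p, _, hp⟩ := hl; ⟨p, hp⟩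
  obtain ⟨q, hq⟩ : ∃ q : Polynomial ℕ, ∀ x : α × β, size (f x.1 x.2) ≤ q.eval (size x) :=
    let ⟨_, q, _, hq⟩ := hf; ⟨q, hq⟩
  have := hl.reverse.foldl_of_size_le (const ([] : List γ))
    (g := fun x : α × (List γ × β) => f x.1 x.2.2 :: x.2.1)
    (cons (hf.comp (fst.pair (snd.comp snd))) (fst.comp snd)) (q.comp (.X + p + 1) + 1)
    fun x s a ha => by
      have h1 := hp x
      have h2 := size_le_of_mem (List.mem_reverse.1 ha)
      have h3 : size (f x a) ≤ q.eval (size (x, a)) := hq (x, a)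
      have h4 : size (x, a) ≤ size x + p.eval (size x) + 1 := by rw [size_pair]; omega
      have h5 := eval_mono q h4
      simp only [size_cons, Polynomial.eval_add, Polynomial.eval_comp, Polynomial.eval_X,
        Polynomial.eval_one]
      omega
  refine this.of_enc_eq (fun x => x) (fun _ => rfl) fun x => ?_
  rw [List.foldl_reverse]
  induction l x <;> simp_all

theorem filter {l : α → List β} (hl : PolyTime I l) {f : α → β → Bool}
    (hf : PolyTime I (fun x : α × β => f x.1 x.2)) : PolyTime I (fun x => (l x).filter (f x)) := by
  obtain ⟨p, hp⟩ : ∃ p : Polynomial ℕ, ∀ x, size (l x) ≤ p.eval (size x) :=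
    let ⟨_, p, _, hp⟩ := hl; ⟨p, hp⟩
  have := hl.reverse.foldl_of_size_le (const ([] : List β))
    (g := fun x : α × (List β × β) => if f x.1 x.2.2 then x.2.2 :: x.2.1 else x.2.1)
    ((hf.comp (fst.pair (snd.comp snd))).cond (cons (snd.comp snd) (fst.comp snd)) (fst.comp snd))
    (p + 1)
    fun x s a ha => by
      have h1 := hp x
      have h2 := size_le_of_mem (List.mem_reverse.1 ha)
      dsimp only
      split_ifs <;> simp only [size_cons, Polynomial.eval_add, Polynomial.eval_one] <;> omega
  refine this.of_enc_eq (fun x => x) (fun _ => rfl) fun x => ?_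
  rw [List.foldl_reverse]
  induction l x with
  | nil => rfl
  | cons a l ih =>
    rw [List.foldr_cons, List.filter_cons]
    split_ifs <;> simp_all [Enc.enc, encValList]

theorem any {l : α → List β} (hl : PolyTime I l) {f : α → β → Bool}
    (hf : PolyTime I (fun x : α × β => f x.1 x.2)) : PolyTime I (fun x => (l x).any (f x)) := by
  refine (hl.filter hf).isEmpty.not.of_enc_eq (fun x => x) (fun _ => rfl) fun x => ?_
  congr 1
  induction l x with
  | nil => rfl
  | cons a l ih => cases h : f x a <;> simp_all

theorem all {l : α → List β} (hl : PolyTime I l) {f : α → β → Bool}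
    (hf : PolyTime I (fun x : α × β => f x.1 x.2)) : PolyTime I (fun x => (l x).all (f x)) := by
  refine (hl.any (f := fun x b => !f x b) hf.not).not.of_enc_eq (fun x => x) (fun _ => rfl) fun x => ?_
  rw [List.all_eq_not_any_not]

end PolyTime

/-! ### Equality tests -/

/-- Types with a polynomial time equality test. -/
def PolyEq (I α : Type) [Enc α] [DecidableEq α] : Prop :=
  PolyTime I (fun x : α × α => decide (x.1 = x.2))

section

variable {I : Type} {α β γ : Type} [Enc α] [Enc β] [Enc γ] [DecidableEq α] [DecidableEq β]

open PolyTime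

theorem PolyEq.test (h : PolyEq I α) {f g : γ → α} (hf : PolyTime I f) (hg : PolyTime I g) :
    PolyTime I (fun x => decide (f x = g x)) :=
  PolyTime.comp₂ h hf hg

theorem PolyEq.prod (hα : PolyEq I α) (hβ : PolyEq I β) : PolyEq I (α × β) := by
  refine ((hα.test (fst.comp fst) (fst.comp snd)).and
    (hβ.test (snd.comp fst) (snd.comp snd))).of_enc_eq (fun x => x) (fun _ => rfl) fun x => ?_
  simp [Prod.ext_iff]

/-- A fold over the first list carries a flag and the unread part of the second; the flag becomes
`false` at a mismatch or if the second list is exhausted. The lists are equal iff at the end the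
flag is `true` and nothing is unread. -/
theorem PolyEq.list (hα : PolyEq I α) : PolyEq I (List α) := by
  have hg : PolyTime I (fun x : (List α × List α) × ((Bool × List α) × α) =>
      match x.2.1.2 with
      | [] => (false, [])
      | b :: l => (x.2.1.1 && decide (x.2.2 = b), l)) :=
    (snd.comp (fst.comp snd)).list_cases (const (false, [])) (g := fun x p =>
      (x.2.1.1 && decide (x.2.2 = p.1), p.2)) (((fst.comp (fst.comp (snd.comp fst))).and
        (hα.test (snd.comp (snd.comp fst)) (fst.comp snd))).pair (snd.comp snd))
  have h := (fst (I := I) (α := List α) (β := List α)).foldl_of_size_le ((PolyTime.const true).pair snd)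
    hg 3 fun x s a _ => by
      rcases s with ⟨u, _ | ⟨b, l⟩⟩
      · have := size_bool_le false
        simp only [size_pair, size_nil, Polynomial.eval_ofNat]
        omega
      · have := size_bool_le (u && decide (a = b))
        simp only [size_pair, size_cons, Polynomial.eval_ofNat]
        omega
  refine ((fst.comp h).and (snd.comp h).isEmpty).of_enc_eq (fun x => x) (fun _ => rfl) ?_
  rintro ⟨l, l'⟩
  congr 1
  have key : ∀ (l l' : List α) (u : Bool), (let r := l.foldl (fun (s : Bool × List α) a =>
      match s.2 with
      | [] => (false, [])
      | b :: l => (s.1 && decide (a = b), l)) (u, l'); r.1 && r.2.isEmpty) =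
      (u && decide (l = l')) := by
    intro l
    induction l with
    | nil => intro l' u; cases l' <;> simp
    | cons a l ih =>
      intro l' u
      cases l' with
      | nil => simpa using ih [] false
      | cons b l' => simpa [Bool.and_assoc] using ih l' (u && decide (a = b))
  simpa using (key l l' true).symm

end

/-! ### Finite types -/

/-- The encoding of the elements of a finite type by unary numbers. -/
noncomputable def encFintype {α : Type} [Fintype α] (a : α) : Val :=
  Enc.enc (List.replicate (Fintype.equivFin α a : ℕ) ())

namespace PolyTime

variable {I : Type} {α β γ δ σ : Type} [Enc α] [Enc β] [Enc γ] [Enc δ] [Enc σ]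

theorem append {f g : α → List β} (hf : PolyTime I f) (hg : PolyTime I g) :
    PolyTime I (fun x => f x ++ g x) := by
  obtain ⟨p, hp⟩ : ∃ p : Polynomial ℕ, ∀ x, size (f x) ≤ p.eval (size x) :=
    let ⟨_, p, _, hp⟩ := hf; ⟨p, hp⟩
  have := hf.reverse.foldl_of_size_le hg
    (g := fun x : α × (List β × β) => x.2.2 :: x.2.1) (cons (snd.comp snd) (fst.comp snd)) (p + 1)
    fun x s a ha => by
      have := hp x
      have := size_le_of_mem (List.mem_reverse.1 ha)
      simp only [size_cons, Polynomial.eval_add, Polynomial.eval_one]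
      omega
  refine this.of_enc_eq (fun x => x) (fun _ => rfl) fun x => ?_
  simp

end PolyTime

theorem PolyEq.unit {I : Type} : PolyEq I Unit :=
  (PolyTime.const true).of_enc_eq (fun x => x) (fun _ => rfl) fun _ => rfl

theorem PolyEq.fintype {I α : Type} [Fintype α] [Enc α] [DecidableEq α]
    (h : ∀ a : α, Enc.enc a = encFintype a) : PolyEq I α := by
  refine (PolyEq.list (α := Unit) .unit).of_enc_eq (fun x : α × α =>
    (List.replicate (Fintype.equivFin α x.1 : ℕ) (), List.replicate (Fintype.equivFin α x.2 : ℕ) ()))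
    (fun x => ?_) fun x => ?_
  · change _ = Val.node (Enc.enc x.1) (Enc.enc x.2)
    rw [h, h]; rfl
  · congr 1
    simp [Fin.val_inj]

/-- Any predicate on a finite type is membership in a constant list. -/
theorem PolyTime.of_fintype {I α β : Type} [Fintype α] [Enc α] [Enc β] [DecidableEq α]
    (h : PolyEq I α) (p : α → Bool) {f : β → α} (hf : PolyTime I f) :
    PolyTime I (fun x => p (f x)) := by
  have := (PolyTime.const (I := I) (α := β) (Finset.univ.filter (p · = true)).toList).any
    (f := fun x c => decide (f x = c)) (h.test (hf.comp .fst) .snd)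
  refine this.of_enc_eq (fun x => x) (fun _ => rfl) fun x => ?_
  congr 1
  rw [Bool.eq_iff_iff]
  simp

/-! ### Solving equations -/

section

variable {T : Type} [DecidableEq T]

/-- The result of a sequence of substitutions. -/
def subst (θ : List (T × T)) (t : T) : T :=
  θ.foldl (fun t e => if t = e.1 then e.2 else t) t

/-- Orient an equation: replace something that is not a constant, if possible. -/
def orient (c : T → Bool) (a b : T) : T × T := if c a then (b, a) else (a, b)

/-- Extend a sequence of substitutions so that it solves the equation `e`. -/
def solveStep (c : T → Bool) (θ : List (T × T)) (e : T × T) : List (T × T) :=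
  θ ++ [orient c (subst θ e.1) (subst θ e.2)]

/-- A sequence of substitutions that solves the equations `E`. -/
def solve (c : T → Bool) (E : List (T × T)) : List (T × T) := E.foldl (solveStep c) []

/-- The decision procedure for the certainty of an instance. The constants are the elements
satisfying `c`, and `bot` marks missing tuples; `eqs` and `neqs` are the equalities and
inequalities of the global condition; a component is a list of rows, a row is a list of tuples. -/
def certain (c : T → Bool) (bot : T) (eqs neqs : List (T × T)) (comps : List (List (List (List T))))
    (facts : List (List T)) : Bool :=
  (comps.any List.isEmpty || ((solve c eqs).any (fun e => c e.1 && !decide (e.1 = e.2)) ||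
    neqs.any (fun e => decide (subst (solve c eqs) e.1 = subst (solve c eqs) e.2)))) ||
  ((comps.all fun C => C.all fun r => r.all fun k =>
    k.any (fun t => decide (t = bot)) ||
      facts.any (fun f => decide (f = k.map (subst (solve c eqs))))) &&
  facts.all fun f => comps.any fun C => C.all fun r => r.any fun k =>
    decide (f = k.map (subst (solve c eqs))))

/-! ### Polynomial running time of the decision procedure -/

variable {I : Type} {α : Type} [Enc T] [Enc α]

open PolyTime

theorem PolyTime.subst (hT : PolyEq I T) {θ : α → List (T × T)} {t : α → T} (hθ : PolyTime I θ)
    (ht : PolyTime I t) : PolyTime I (fun x => subst (θ x) (t x)) := by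
  obtain ⟨p, hp⟩ : ∃ p : Polynomial ℕ, ∀ x, size (θ x) ≤ p.eval (size x) :=
    let ⟨_, p, _, hp⟩ := hθ; ⟨p, hp⟩
  have := hθ.foldl_of_size_le ht
    (g := fun x : α × (T × (T × T)) => if decide (x.2.1 = x.2.2.1) then x.2.2.2 else x.2.1)
    ((hT.test (fst.comp snd) (fst.comp (snd.comp snd))).cond (snd.comp (snd.comp snd))
      (fst.comp snd)) p
    fun x s a ha => by
      have h1 := hp x
      have h2 := size_le_of_mem ha
      rw [← Prod.mk.eta (p := a), size_pair] at h2
      dsimp only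
      split_ifs <;> omega
  refine this.of_enc_eq (fun x => x) (fun _ => rfl) fun x => ?_
  simp [StackMachine.subst]

/-- Substitution replaces a whole term by a right-hand side, so nothing is ever nested. -/
theorem size_subst_le {N : ℕ} {θ : List (T × T)} (hθ : ∀ e ∈ θ, size e.2 ≤ N) {t : T}
    (ht : size t ≤ N) : size (StackMachine.subst θ t) ≤ N := by
  induction θ generalizing t with
  | nil => exact ht
  | cons e θ ih =>
    refine ih (fun e he => hθ e (List.mem_cons_of_mem _ he)) ?_
    dsimp only
    split_ifs
    · exact hθ e List.mem_cons_self
    · exact ht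

/-- Each equation contributes one entry, whose two terms are no larger than the largest term of `E`;
an entry costs at most `2 * N + 1` and its list cell one more. -/
theorem size_solve_le (c : T → Bool) {N : ℕ} (E : List (T × T))
    (hE : ∀ e ∈ E, size e.1 ≤ N ∧ size e.2 ≤ N) :
    size (solve c E) ≤ 1 + E.length * (2 * N + 2) := by
  suffices h : (∀ e ∈ solve c E, size e.1 ≤ N ∧ size e.2 ≤ N) ∧
      (solve c E).length = E.length by
    rw [← h.2]
    have key : ∀ θ : List (T × T), (∀ e ∈ θ, size e.1 ≤ N ∧ size e.2 ≤ N) →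
        size θ ≤ 1 + θ.length * (2 * N + 2) := by
      intro θ hθ
      induction θ with
      | nil => simp [size_nil]
      | cons e θ ih =>
        have h1 := ih fun e he => hθ e (List.mem_cons_of_mem _ he)
        have h2 := hθ e List.mem_cons_self
        rw [size_cons, ← Prod.mk.eta (p := e), size_pair, List.length_cons, Nat.add_mul]
        omega
    exact key _ h.1
  induction E using List.reverseRecOn with
  | nil => simp [solve]
  | append_singleton E e ih =>
    obtain ⟨h1, h2⟩ := ih fun e he => hE e (by simp [he])
    have h3 := hE e (by simp)
    have h4 := size_subst_le (fun e he => (h1 e he).2) h3.1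
    have h5 := size_subst_le (fun e he => (h1 e he).2) h3.2
    rw [solve, List.foldl_append, ← solve]
    simp only [List.foldl_cons, List.foldl_nil, solveStep, List.length_append, List.length_cons,
      List.length_nil, h2, and_true, List.mem_append, List.mem_singleton]
    rintro e' (he' | rfl)
    · exact h1 e' he'
    · unfold orient
      split_ifs
      · exact ⟨h5, h4⟩
      · exact ⟨h4, h5⟩

/-- The entry appended in a step may contain terms of the current state, so `foldl_of_size_le` does
not apply directly; the intermediate states are bounded by `size_solve_le`. -/
theorem PolyTime.solve (hT : PolyEq I T) {c : T → Bool} (hc : PolyTime I c)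
    {E : α → List (T × T)} (hE : PolyTime I E) : PolyTime I (fun x => solve c (E x)) := by
  obtain ⟨p, hp⟩ : ∃ p : Polynomial ℕ, ∀ x, size (E x) ≤ p.eval (size x) :=
    let ⟨_, p, _, hp⟩ := hE; ⟨p, hp⟩
  have h1 : PolyTime I (fun x : α × (List (T × T) × (T × T)) => StackMachine.subst x.2.1 x.2.2.1) :=
    PolyTime.subst hT (fst.comp snd) (fst.comp (snd.comp snd))
  have h2 : PolyTime I (fun x : α × (List (T × T) × (T × T)) => StackMachine.subst x.2.1 x.2.2.2) :=
    PolyTime.subst hT (fst.comp snd) (snd.comp (snd.comp snd))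
  exact hE.foldl (PolyTime.const []) (g := fun x => solveStep c x.2.1 x.2.2)
    ((fst.comp snd).append (((hc.comp h1).cond (h2.pair h1) (h1.pair h2)).cons (PolyTime.const [])))
    (1 + p * (2 * p + 2)) fun x l hl => by
      have h3 := hp x
      have h4 : l.length ≤ p.eval (size x) :=
        (hl.length_le.trans (length_lt_size (E x)).le).trans h3
      have h5 := size_solve_le c (N := p.eval (size x)) l fun e he => by
        have := size_le_of_mem (hl.subset he)
        rw [← Prod.mk.eta (p := e), size_pair] at this
        omega
      have h6 := Nat.mul_le_mul_right (2 * p.eval (size x) + 2) h4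
      change size (StackMachine.solve c l) ≤ _
      simp only [Polynomial.eval_add, Polynomial.eval_mul, Polynomial.eval_one,
        Polynomial.eval_ofNat]
      omega

theorem PolyTime.certain (hT : PolyEq I T) {c : T → Bool} (hc : PolyTime I c) (bot : T)
    {eqs neqs : α → List (T × T)} {comps : α → List (List (List (List T)))}
    {facts : α → List (List T)} (heqs : PolyTime I eqs) (hneqs : PolyTime I neqs)
    (hcomps : PolyTime I comps) (hfacts : PolyTime I facts) :
    PolyTime I (fun x => certain c bot (eqs x) (neqs x) (comps x) (facts x)) := by
  have hs := PolyTime.solve hT hc heqs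
  have h1 : PolyTime I (fun x => (comps x).any List.isEmpty) := hcomps.any (isEmpty snd)
  have h2 : PolyTime I (fun x => (StackMachine.solve c (eqs x)).any
      (fun e => c e.1 && !decide (e.1 = e.2))) :=
    hs.any ((hc.comp (fst.comp snd)).and (hT.test (fst.comp snd) (snd.comp snd)).not)
  have h3 : PolyTime I (fun x => (neqs x).any (fun e => decide
      (StackMachine.subst (StackMachine.solve c (eqs x)) e.1 =
        StackMachine.subst (StackMachine.solve c (eqs x)) e.2))) :=
    hneqs.any (hT.test (PolyTime.subst hT (hs.comp fst) (fst.comp snd))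
      (PolyTime.subst hT (hs.comp fst) (snd.comp snd)))
  have hk : PolyTime I (fun x : α × List T =>
      x.2.map (StackMachine.subst (StackMachine.solve c (eqs x.1)))) :=
    PolyTime.map snd (f := fun x t => StackMachine.subst (StackMachine.solve c (eqs x.1)) t)
      (PolyTime.subst hT (hs.comp (fst.comp fst)) snd)
  have hK : PolyEq I (List T) := hT.list
  let φ : α → List T → Bool := fun x k => k.any (fun t => decide (t = bot)) || (facts x).any
    (fun f => decide (f = k.map (StackMachine.subst (StackMachine.solve c (eqs x)))))
  let ψ : α → List T → List T → Bool := fun x f k =>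
    decide (f = k.map (StackMachine.subst (StackMachine.solve c (eqs x))))
  have hφ : PolyTime I (fun x : α × List T => φ x.1 x.2) :=
    (PolyTime.any snd (f := fun _ t => decide (t = bot)) (hT.test snd (PolyTime.const bot))).or
      (PolyTime.any (hfacts.comp fst) (f := fun (x : α × List T) f => decide (f = x.2.map
        (StackMachine.subst (StackMachine.solve c (eqs x.1))))) (hK.test snd (hk.comp fst)))
  have hψ : PolyTime I (fun x : (α × List T) × List T => ψ x.1.1 x.1.2 x.2) :=
    hK.test (snd.comp fst) (hk.comp ((fst.comp fst).pair snd))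
  have h4 : PolyTime I (fun x => (comps x).all fun C => C.all fun r => r.all fun k => φ x k) :=
    hcomps.all (f := fun x C => C.all fun r => r.all fun k => φ x k)
      (PolyTime.all snd (f := fun (x : α × List (List (List T))) r => r.all fun k => φ x.1 k)
        (PolyTime.all snd (f := fun (x : (α × List (List (List T))) × List (List T)) k => φ x.1.1 k)
          (hφ.comp ((fst.comp (fst.comp fst)).pair snd))))
  have h5 : PolyTime I (fun x => (facts x).all fun f => (comps x).any fun C => C.all fun r =>
      r.any fun k => ψ x f k) :=
    hfacts.all (f := fun x f => (comps x).any fun C => C.all fun r => r.any fun k => ψ x f k)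
      (PolyTime.any (hcomps.comp fst) (f := fun (x : α × List T) C => C.all fun r =>
          r.any fun k => ψ x.1 x.2 k)
        (PolyTime.all snd (f := fun (x : (α × List T) × List (List (List T))) r =>
          r.any fun k => ψ x.1.1 x.1.2 k)
          (PolyTime.any snd (f := fun (x : ((α × List T) × List (List (List T))) × List (List T)) k =>
            ψ x.1.1.1 x.1.1.2 k)
            (hψ.comp ((fst.comp (fst.comp fst)).pair snd)))))
  exact (h1.or (h2.or h3)).or (h4.and h5)

end

/-! ### From functions on trees to Turing machines -/

/-- Push the encoding of the input symbol `s` as an additional entry of a list. -/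
theorem exists_runLe_cons {I : Type} [Enc I] [Fintype I] [DecidableEq I] :
    ∃ (P : Prog (Alphabet I)) (n : ℕ), ∀ (s : I) (l : List I) i o r a b,
      RunLe P (st (s :: i) o ((Enc.enc l).code ++ r) a b [])
        (st i o ((Enc.enc (s :: l)).code ++ r) a b []) n := by
  -- The program is a cascade of tests, one for each symbol of the finite alphabet; induction builds
  -- it.
  suffices h : ∀ L : List I, ∃ (P : Prog (Alphabet I)) (n : ℕ), ∀ s ∈ L, ∀ (l : List I) i o r a b,
      RunLe P (st (s :: i) o ((Enc.enc l).code ++ r) a b [])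
        (st i o ((Enc.enc (s :: l)).code ++ r) a b []) n by
    obtain ⟨P, n, h⟩ := h Finset.univ.toList
    exact ⟨P, n, fun s => h s (by simp)⟩
  intro L
  induction L with
  | nil => exact ⟨.skip, 0, by simp⟩
  | cons t L ih =>
    obtain ⟨P, n, hP⟩ := ih
    obtain ⟨Q, m, hQ⟩ := PolyTime.exists_runLe_build (I := I) (Enc.enc t)
    refine ⟨.ite Stk.inp (fun x : Option I => decide (x = some t))
      (.seq (.pop Stk.inp) (.seq Q (.push Stk.main .node))) P, 1 + (m + 1) + n + 1,
      fun s hs l i o r a b => ?_⟩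
    by_cases hst : s = t
    · subst hst
      have h : RunLe _ _ (st i o ((Enc.enc (s :: l)).code ++ r) a b []) _ :=
        (pop_inp (x := s) (i := i)).seq ((hQ i o ((Enc.enc l).code ++ r) a b).seq
        (by simpa [Enc.enc, Val.code, encValList] using push_main (s := .node)))
      exact (RunLe.ite_true (k := Stk.inp) (p := fun x : Option I => decide (x = some s))
        (Q := P) (S := st (s :: i) o ((Enc.enc l).code ++ r) a b []) (decide_eq_true (p := some s = some s) rfl) h).mono (by omega)
    · refine (RunLe.ite_false (k := Stk.inp) (p := fun x : Option I => decide (x = some t))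
        (S := st (s :: i) o ((Enc.enc l).code ++ r) a b []) (decide_eq_false (p := some s = some t) (by simp [hst])) (hP s ?_ l i o r a b)).mono (by omega)
      simpa [hst] using hs

/-- A polynomial time function on reversed strings gives rise to a program for Booleans. -/
theorem exists_runLe_decide {I : Type} [Enc I] [Fintype I] [DecidableEq I] {f : List I → Bool}
    (hf : PolyTime I f) : ∃ (P : Prog (Alphabet I)) (p : Polynomial ℕ), ∀ l : List I,
      RunLe P (st l [] [] [] [] []) (st [] [f l.reverse] [] [] [] []) (p.eval l.length) := by
  obtain ⟨P, n, hP⟩ := exists_runLe_cons (I := I)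
  obtain ⟨Q, q, hQ, -⟩ := hf
  obtain ⟨N, hN⟩ : ∃ N : ℕ, ∀ s : I, size s ≤ N :=
    ⟨Finset.univ.sup size, fun s => Finset.le_sup (Finset.mem_univ s)⟩
  -- Consing the input symbols one by one reverses the string.
  have hload : ∀ l l' : List I, RunLe (.loop Stk.inp (fun x : Option I => x.isSome) P)
      (st l [] ((Enc.enc l').code ++ []) [] [] [])
      (st [] [] ((Enc.enc (l.reverse ++ l')).code ++ []) [] [] []) ((n + 1) * l.length + 1) := by
    intro l
    induction l with
    | nil => exact fun l' => .loop_false rfl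
    | cons s l ih =>
      intro l'
      have := RunLe.loop_true (k := Stk.inp) (p := fun x : Option I => x.isSome) rfl
        (hP s l' l [] [] [] []) (ih (s :: l'))
      refine RunLe.mono (by simpa using this) ?_
      rw [List.length_cons, Nat.mul_succ]
      omega
  have hsize : ∀ l : List I, size l ≤ (N + 1) * l.length + 1 := by
    intro l
    induction l with
    | nil => simp [size_nil]
    | cons s l ih =>
      have := hN s
      rw [size_cons, List.length_cons, Nat.mul_succ]
      omega
  refine ⟨.seq (.push Stk.main .leaf) (.seq (.loop Stk.inp (fun x : Option I => x.isSome) P)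
    (.seq Q (.ite Stk.main isLeaf (.seq (.pop Stk.main) (.push Stk.out false))
      (.seq (.pop Stk.main) (.seq (.pop Stk.main) (.seq (.pop Stk.main) (.push Stk.out true))))))),
    1 + (.C (n + 1) * .X + 1 + (q.comp (.C (N + 1) * .X + 1) + 5)), fun l => ?_⟩
  have h1 := hload l []
  have h2 := hQ l.reverse [] [] [] [] []
  have h3 : RunLe (.ite Stk.main isLeaf (.seq (.pop Stk.main) (.push Stk.out false))
      (.seq (.pop Stk.main) (.seq (.pop Stk.main) (.seq (.pop Stk.main) (.push Stk.out true)))))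
      (st ([] : List I) [] ((Enc.enc (f l.reverse)).code ++ []) [] [] [])
      (st [] [f l.reverse] [] [] [] []) 5 := by
    -- The code of `false` is one symbol, that of `true` three. All are popped, since only the
    -- output stack may be nonempty upon halting.
    cases f l.reverse
    · exact (RunLe.ite_true (k := Stk.main) (p := isLeaf)
        (S := st ([] : List I) [] [Tok.leaf] [] [] []) rfl (.seq pop_main push_out)).mono (by omega)
    · exact (RunLe.ite_false (k := Stk.main) (p := isLeaf)
        (S := st ([] : List I) [] [Tok.node, Tok.leaf, Tok.leaf] [] [] []) rfl
        (.seq pop_main (.seq pop_main (.seq pop_main push_out)))).mono (by omega)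
  rw [l.reverse.append_nil] at h1
  refine RunLe.mono (RunLe.seq push_main (h1.seq (h2.seq h3))) ?_
  have h4 := eval_mono q (hsize l.reverse)
  rw [List.length_reverse] at h4
  simp only [Polynomial.eval_add, Polynomial.eval_mul, Polynomial.eval_comp, Polynomial.eval_X,
    Polynomial.eval_C, Polynomial.eval_one, Polynomial.eval_ofNat]
  omega

instance {I : Type} [Fintype I] : Fintype (Alphabet I Stk.inp) := inferInstanceAs (Fintype I)

/-- The Turing machine of a program. -/
def toFinTM2 {I : Type} [Fintype I] (P : Prog (Alphabet I)) : FinTM2 where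
  K := Stk
  k₀ := .inp
  k₁ := .out
  Γ := Alphabet I
  Λ := Option P.Label
  main := some P.entry
  σ := Bool
  initialState := false
  m := P.machine

/-- A polynomial time function on reversed strings is computed by a polynomial time Turing
machine. -/
theorem PolyTime.nonempty_tm2ComputableInPolyTime {α I : Type} [Enc I] [Fintype I] [DecidableEq I]
    {f : List I → Bool} (hf : PolyTime I f) (e : α → List I) {g : α → Bool}
    (hg : ∀ a, g a = f (e a).reverse) :
    Nonempty (TM2ComputableInPolyTime e Computability.encodeBool g) := by
  obtain ⟨P, p, hP⟩ := exists_runLe_decide hf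
  choose n hn hr using hP
  refine ⟨{ tm := toFinTM2 P
            inputAlphabet := Equiv.refl I
            outputAlphabet := Equiv.refl Bool
            -- One step is added for halting.
            time := p + 1
            outputsFun := fun a =>
              { steps := n (e a) + 1
                evals_in_steps := ?_
                steps_le_m := by simpa using hn (e a) } }⟩
  have h := (hr (e a)).machine.iterate
  have h1 : initList (toFinTM2 P) ((e a).map (Equiv.refl I).invFun) =
      ⟨some (some P.entry), false, st (e a) [] [] [] [] []⟩ := by
    simp only [initList, toFinTM2]
    congr 1
    funext k
    cases k <;> simp [st]
    exacts [List.map_id _, rfl, rfl, rfl, rfl, rfl]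
  have h2 : haltList (toFinTM2 P) ((Computability.encodeBool (g a)).map (Equiv.refl Bool).invFun) =
      ⟨none, false, st [] [f (e a).reverse] [] [] [] []⟩ := by
    simp only [haltList, toFinTM2]
    congr 1
    funext k
    cases k <;> simp [st, hg, Computability.encodeBool] <;> rfl
  rw [Option.map_some, h1, h2]
  exact h

end StackMachine

namespace WSD

open Function StackMachine

section

open StackMachine.PolyTime

/-! ### Reading the input -/

noncomputable instance : Enc Sym := ⟨encFintype⟩

/-- A symbol with the bit string that follows it. -/
abbrev Token : Type := Sym × List Sym

/-- The state of the reader, which processes its input from right to left: the current bit string,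
the tokens of the current tuple, the tuples of the current row or list of facts, the rows of the
current component, the components, the literals, and the facts. A tuple comes with the bit string
that follows `Sym.tup`, and a literal with its first symbol. -/
abbrev Parse : Type :=
  List Sym × List Token × List (List Sym × List Token) × List (List (List Sym × List Token)) ×
    List (List (List (List Sym × List Token))) × List (Sym × List Token) ×
    List (List Sym × List Token)

/-- The symbols `Sym.bit b`. -/
def Sym.isBit : Sym → Bool
  | .bit _ => true
  | _ => false

/-- The symbols that are kept as tokens of a tuple or of a literal. -/
def Sym.isToken : Sym → Bool
  | .eow => true
  | .const => true
  | .var => true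
  | .bot => true
  | _ => false

/-- The symbols at the beginning of a literal. -/
def Sym.isLit : Sym → Bool
  | .eq => true
  | .ne => true
  | _ => false

/-- One step of the reader. -/
def parseStep : Parse → Sym → Parse
  | (w, k, ts, rs, cs, ls, fs), s =>
    if s.isBit then (s :: w, k, ts, rs, cs, ls, fs)
    else if s.isToken then ([], (s, w) :: k, ts, rs, cs, ls, fs)
    -- Reading from the right, an opening symbol is met after its contents and collects what has
    -- accumulated.
    else if decide (s = .tup) then ([], [], (w, k) :: ts, rs, cs, ls, fs)
    else if s.isLit then ([], [], ts, rs, cs, (s, k) :: ls, fs)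
    else if decide (s = .row) then ([], [], [], ts :: rs, cs, ls, fs)
    -- In an encoded input only the facts can still be waiting in `ts` here: tuples of rows have
    -- been collected by `row`, and identifier lists discarded by `comp`.
    else if decide (s = .close) then ([], [], [], rs, cs, ls, ts ++ fs)
    else if decide (s = .comp) then ([], [], [], [], rs :: cs, ls, fs)
    else ([], [], ts, rs, cs, ls, fs)

/-- Read a string from right to left. -/
def parse (l : List Sym) : Parse :=
  l.foldr (fun s p => parseStep p s) ([], [], [], [], [], [], [])

/-- Is a token a constant? -/
def isConstToken (t : Token) : Bool := decide (t.1 = .const)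

/-- The two sides of a literal. -/
def sides (l : Sym × List Token) : Token × Token :=
  -- The tokens of a literal are its left side, an end marker, its right side, an end marker. The
  -- default values do not occur for encoded inputs.
  (l.2.headD (.bot, []), l.2.tail.tail.headD (.bot, []))

/-- The tuple of a fact, in the form in which tuples of rows are represented. -/
def factKey (f : List Sym × List Token) : List Token := (.eow, f.1) :: f.2

/-- The decision procedure, applied to the result of the reader. -/
def decideParse (p : Parse) : Bool :=
  certain isConstToken (.bot, []) ((p.2.2.2.2.2.1.filter fun l => decide (l.1 = .eq)).map sides)
    ((p.2.2.2.2.2.1.filter fun l => decide (l.1 = .ne)).map sides)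
    (p.2.2.2.2.1.map fun C => C.map fun r => r.map Prod.snd) (p.2.2.2.2.2.2.map factKey)

theorem polyEq_sym : PolyEq Sym Sym := PolyEq.fintype fun _ => rfl

theorem polyEq_token : PolyEq Sym Token := polyEq_sym.prod polyEq_sym.list

variable {α : Type} [Enc α]

theorem polyTime_sym_decide {s : α → Sym} (hs : PolyTime Sym s) (c : Sym) :
    PolyTime Sym (fun x => decide (s x = c)) :=
  polyEq_sym.test hs (PolyTime.const c)

theorem polyTime_parseStep : PolyTime Sym (fun x : Parse × Sym => parseStep x.1 x.2) := by
  have hs : PolyTime Sym (fun x : Parse × Sym => x.2) := snd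
  have p1 : PolyTime Sym (fun x : Parse × Sym => x.1.1) := fst.comp fst
  have q1 : PolyTime Sym (fun x : Parse × Sym => x.1.2) := snd.comp fst
  have p2 := fst.comp q1
  have q2 := snd.comp q1
  have p3 := fst.comp q2
  have q3 := snd.comp q2
  have p4 := fst.comp q3
  have q4 := snd.comp q3
  have p5 := fst.comp q4
  have q5 := snd.comp q4
  have p6 := fst.comp q5
  have p7 := snd.comp q5
  have e {β : Type} [Enc β] : PolyTime Sym (fun _ : Parse × Sym => ([] : List β)) :=
    PolyTime.const []
  exact (of_fintype polyEq_sym Sym.isBit hs).cond ((hs.cons p1).pair q1) <|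
    (of_fintype polyEq_sym Sym.isToken hs).cond (e.pair (((hs.pair p1).cons p2).pair q2)) <|
    (polyTime_sym_decide hs .tup).cond (e.pair (e.pair (((p1.pair p2).cons p3).pair q3))) <|
    (of_fintype polyEq_sym Sym.isLit hs).cond (e.pair (e.pair (p3.pair (p4.pair (p5.pair
      (((hs.pair p2).cons p6).pair p7)))))) <|
    (polyTime_sym_decide hs .row).cond (e.pair (e.pair (e.pair ((p3.cons p4).pair q4)))) <|
    (polyTime_sym_decide hs .close).cond
      (e.pair (e.pair (e.pair (p4.pair (p5.pair (p6.pair (p3.append p7))))))) <|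
    (polyTime_sym_decide hs .comp).cond
      (e.pair (e.pair (e.pair (e.pair ((p4.cons p5).pair q5))))) <|
    (e.pair (e.pair q2))

/-- A step moves parts of the state without copying them, so the state grows by at most a constant.
The reversal matches the order in which the machine loads its input and turns the right fold into a
left fold. -/
theorem polyTime_parse : PolyTime Sym (fun l : List Sym => parse l.reverse) := by
  obtain ⟨N, hN⟩ : ∃ N : ℕ, ∀ s : Sym, size s ≤ N :=
    ⟨Finset.univ.sup size, fun s => Finset.le_sup (Finset.mem_univ s)⟩
  have h := (PolyTime.id (I := Sym) (α := List Sym)).foldl_of_size_le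
    (PolyTime.const (([], [], [], [], [], [], []) : Parse))
    (g := fun x => parseStep x.2.1 x.2.2) (polyTime_parseStep.comp snd) (.C (N + 10)) (by
      rintro x ⟨w, k, ts, rs, cs, ls, fs⟩ s -
      have h1 := hN s
      have h2 := size_append ts fs
      rw [Polynomial.eval_C]
      have := size_pos w
      have := size_pos k
      have := size_pos ts
      have := size_pos rs
      simp only [parseStep]
      split_ifs <;> simp only [size_pair, size_cons, size_nil] <;> omega)
  refine h.of_enc_eq (fun x => x) (fun _ => rfl) fun l => ?_
  simp only [parse, List.foldr_reverse]

theorem polyTime_decideParse : PolyTime Sym decideParse := by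
  have p5 : PolyTime Sym (fun p : Parse => p.2.2.2.2.1) :=
    fst.comp (snd.comp (snd.comp (snd.comp snd)))
  have q5 : PolyTime Sym (fun p : Parse => p.2.2.2.2.2) :=
    snd.comp (snd.comp (snd.comp (snd.comp snd)))
  have hsides : PolyTime Sym sides :=
    (headD snd _).pair (headD (tail (tail snd)) _)
  have hlits (c : Sym) : PolyTime Sym (fun p : Parse =>
      (p.2.2.2.2.2.1.filter fun l => decide (l.1 = c)).map sides) :=
    PolyTime.map (f := fun _ l => sides l)
      (PolyTime.filter (fst.comp q5) (f := fun _ l => decide (l.1 = c))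
        (polyTime_sym_decide (fst.comp snd) c)) (hsides.comp snd)
  refine PolyTime.certain polyEq_token (polyTime_sym_decide fst .const) _ (hlits .eq) (hlits .ne)
    (PolyTime.map p5 (f := fun _ C => C.map fun r => r.map Prod.snd)
      (PolyTime.map snd (f := fun _ (r : List (List Sym × List Token)) => r.map Prod.snd)
        (PolyTime.map snd (f := fun _ (k : List Sym × List Token) => k.2) (snd.comp snd))))
    (PolyTime.map (snd.comp q5) (f := fun _ f => factKey f) ?_)
  exact ((PolyTime.const Sym.eow).pair (fst.comp snd)).cons (snd.comp snd)

end

/-! ### The result of reading an encoded input -/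

section

variable {D X : Type} (eD : D ↪ List Bool) (eX : X ↪ List Bool) {S : Schema}

/-- The token of a term. -/
def Term.token : Term D X → Token
  | .const d => (.const, (eD d).map .bit)
  | .var x => (.var, (eX x).map .bit)

/-- The tokens of a field. -/
def fieldTokens : Field D X → List Token
  | none => [(.bot, [])]
  | some t => [t.token eD eX, (.eow, [])]

/-- The tokens of a tuple. -/
def tupleTokens {n : ℕ} (t : Fin n → Field D X) : List Token :=
  (List.ofFn t).flatMap (fieldTokens eD eX)

/-- A number as a string. -/
def natBits (n : ℕ) : List Sym := (Computability.encodeNat n).map .bit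

/-- The tokens of a tuple of the relation `R`, including the name of `R`. -/
def relTokens (R : S.Rel) (t : Tuple S R (Field D X)) : List Token :=
  (.eow, natBits R) :: (.eow, []) :: tupleTokens eD eX t

/-- The tuples of a row. -/
def rowTokens {L : List (TupleId S)} (w : Row S D X L) : List (List Sym × List Token) :=
  L.attach.map fun s => (natBits s.1.num, relTokens eD eX s.1.rel (w s))

/-- The rows of a component. -/
def componentTokens (C : Component S D X) : List (List (List Sym × List Token)) :=
  C.rows.map (rowTokens eD eX)

/-- The tokens of a literal. -/
def literalTokens (l : Literal D X) : Sym × List Token :=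
  (if l.positive = true then .eq else .ne,
    [l.lhs.token eD eX, (.eow, []), l.rhs.token eD eX, (.eow, [])])

/-- The tokens of a fact. -/
def factTokens (f : (R : S.Rel) × Tuple S R D) : List Sym × List Token :=
  (natBits f.1, (.eow, []) :: tupleTokens eD eX (fun j => some (.const (f.2 j))))

theorem parse_cons (s : Sym) (l : List Sym) : parse (s :: l) = parseStep (parse l) s := rfl

/-- A bit string gets attached to the symbol on its left. Thus the end marker is stored with the
string `v` that follows it, and the bits of `b` stay pending. -/
theorem parse_encBits {v k y} (b : List Bool) {r : List Sym} (h : parse r = (v, k, y)) :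
    parse (encBits b ++ r) = (b.map .bit, (.eow, v) :: k, y) := by
  induction b with
  | nil =>
    change parseStep (parse r) .eow = _
    rw [h]; rfl
  | cons b l ih =>
    change parseStep (parse (encBits l ++ r)) (.bit b) = _
    rw [ih]; rfl

theorem parse_encTerm {k y} (t : Term D X) {r : List Sym} (h : parse r = ([], k, y)) :
    parse (encTerm eD eX t ++ r) = ([], t.token eD eX :: (.eow, []) :: k, y) := by
  cases t <;> simp only [encTerm, List.cons_append, parse_cons, parse_encBits _ h] <;> rfl

theorem parse_encField {k y} (f : Field D X) {r : List Sym} (h : parse r = ([], k, y)) :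
    parse (encField eD eX f ++ r) = ([], fieldTokens eD eX f ++ k, y) := by
  cases f with
  | none =>
    change parseStep (parse r) .bot = _
    rw [h]; rfl
  | some t => exact parse_encTerm eD eX t h

theorem parse_encTuple {n : ℕ} {k y} (t : Fin n → Field D X) {r : List Sym}
    (h : parse r = ([], k, y)) :
    parse (encTuple (encField eD eX) t ++ r) = ([], tupleTokens eD eX t ++ k, y) := by
  unfold encTuple tupleTokens
  induction List.ofFn t with
  | nil => exact h
  | cons f l ih =>
    rw [List.flatMap_cons, List.append_assoc, parse_encField eD eX f ih, List.flatMap_cons,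
      List.append_assoc]

theorem parse_encTuple_const {n : ℕ} {k y} (t : Fin n → D) {r : List Sym}
    (h : parse r = ([], k, y)) :
    parse (encTuple (fun d => Sym.const :: encBits (eD d)) t ++ r) =
      ([], tupleTokens eD eX (fun j => some (Term.const (t j))) ++ k, y) := by
  rw [← parse_encTuple eD eX _ h]
  simp [encTuple, List.ofFn_eq_map, List.flatMap_map, encField, encTerm]

theorem parse_close {w k ts rs cs ls fs} {r : List Sym}
    (h : parse r = (w, k, ts, rs, cs, ls, fs)) :
    parse (.close :: r) = ([], [], [], rs, cs, ls, ts ++ fs) := by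
  rw [parse_cons, h]; rfl

theorem parse_encRow {w k rs cs ls fs} {L : List (TupleId S)} (u : Row S D X L) {r : List Sym}
    (h : parse r = (w, k, [], rs, cs, ls, fs)) :
    parse (encRow eD eX u ++ r) = ([], [], rowTokens eD eX u, rs, cs, ls, fs) := by
  unfold encRow rowTokens
  rw [List.append_assoc]
  induction L.attach with
  | nil => exact parse_close h
  | cons s l ih =>
    rw [List.flatMap_cons, List.append_assoc, List.cons_append, parse_cons]
    rw [encId, encNat, encNat]
    rw [List.append_assoc, List.append_assoc,
      parse_encBits _ (parse_encBits _ (parse_encTuple eD eX _ ih)), List.map_cons,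
      List.append_nil]
    rfl

/-- The tuples produced here are irrelevant, because `Sym.comp` discards them; hence the existential
statement. -/
theorem parse_encIds {w k rs cs ls fs} (L : List (TupleId S)) {r : List Sym}
    (h : parse r = (w, k, [], rs, cs, ls, fs)) :
    ∃ ts, parse (encList .tup encId L ++ r) = ([], [], ts, rs, cs, ls, fs) := by
  unfold encList
  rw [List.append_assoc]
  induction L with
  | nil => exact ⟨_, parse_close h⟩
  | cons s L ih =>
    obtain ⟨ts, ih⟩ := ih
    rw [List.flatMap_cons, List.append_assoc, List.cons_append, parse_cons]
    rw [encId, encNat, encNat]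
    rw [List.append_assoc, parse_encBits _ (parse_encBits _ ih)]
    exact ⟨_, rfl⟩

theorem parse_encRows {w k rs cs ls fs} {L : List (TupleId S)} (us : List (Row S D X L))
    {r : List Sym} (h : parse r = (w, k, [], rs, cs, ls, fs)) :
    parse (encList .row (encRow eD eX) us ++ r) =
      ([], [], [], us.map (rowTokens eD eX) ++ rs, cs, ls, fs) := by
  unfold encList
  rw [List.append_assoc]
  induction us with
  | nil => exact parse_close h
  | cons u us ih =>
    rw [List.flatMap_cons, List.append_assoc, List.cons_append, parse_cons, parse_encRow eD eX u ih]
    rfl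

theorem parse_encComps {w k ts cs ls fs} (Cs : List (Component S D X)) {r : List Sym}
    (h : parse r = (w, k, ts, [], cs, ls, fs)) :
    parse (encList .comp (encComponent eD eX) Cs ++ r) =
      ([], [], [], [], Cs.map (componentTokens eD eX) ++ cs, ls, ts ++ fs) := by
  unfold encList
  rw [List.append_assoc]
  induction Cs with
  | nil => exact parse_close h
  | cons C Cs ih =>
    rw [List.flatMap_cons, List.append_assoc, List.cons_append, parse_cons]
    rw [encComponent]
    obtain ⟨ts', h'⟩ := parse_encIds C.ids (parse_encRows eD eX C.rows ih)
    rw [List.append_assoc, h', List.append_nil]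
    rfl

theorem parse_encLiterals {w k ts rs cs ls fs} (φ : Condition D X) {r : List Sym}
    (h : parse r = (w, k, ts, rs, cs, ls, fs)) :
    parse (encList .lit (encLiteral eD eX) φ ++ r) =
      ([], [], [], rs, cs, φ.map (literalTokens eD eX) ++ ls, ts ++ fs) := by
  unfold encList
  rw [List.append_assoc]
  induction φ with
  | nil => exact parse_close h
  | cons l φ ih =>
    rw [List.flatMap_cons, List.append_assoc, List.cons_append, parse_cons]
    rw [encLiteral]
    rw [List.cons_append, List.append_assoc, parse_cons,
      parse_encTerm eD eX _ (parse_encTerm eD eX _ ih)]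
    rcases l with ⟨_ | _, a, b⟩ <;> rfl

theorem parse_encFacts {w k rs cs ls fs} (F : List ((R : S.Rel) × Tuple S R D)) {r : List Sym}
    (h : parse r = (w, k, [], rs, cs, ls, fs)) :
    parse (encList .tup (encFact eD) F ++ r) =
      ([], [], F.map (factTokens eD eX), rs, cs, ls, fs) := by
  unfold encList
  rw [List.append_assoc]
  induction F with
  | nil => exact parse_close h
  | cons f F ih =>
    rw [List.flatMap_cons, List.append_assoc, List.cons_append, parse_cons]
    rw [encFact, encNat]
    rw [List.append_assoc, parse_encBits _ (parse_encTuple_const eD eX _ ih), List.append_nil]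
    rfl

theorem parse_encSchema {w k rs cs ls fs} (S : Schema) {r : List Sym}
    (h : parse r = (w, k, [], rs, cs, ls, fs)) :
    parse (encSchema S ++ r) = ([], [], [], rs, cs, ls, fs) := by
  unfold encSchema encList
  rw [List.append_assoc]
  induction S.arities with
  | nil => exact parse_close h
  | cons n l ih =>
    rw [List.flatMap_cons, List.append_assoc, List.cons_append, parse_cons]
    rw [encNat, parse_encBits _ ih]
    rfl

theorem parse_encInput (p : Input D X) :
    parse (encInput eD eX p) = ([], [], [], [], p.wsd.comps.map (componentTokens eD eX),
      p.wsd.cond.map (literalTokens eD eX), p.inst.map (factTokens eD eX)) := by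
  have h1 := parse_encFacts eD eX p.inst (r := []) rfl
  have h2 := parse_encLiterals eD eX p.wsd.cond h1
  have h3 := parse_encComps eD eX p.wsd.comps h2
  have h4 := parse_encSchema p.schema h3
  simpa [encInput, encGWSD] using h4

/-- The decision procedure, applied to an encoded input. -/
theorem decideParse_encInput (p : Input D X) :
    decideParse (parse (encInput eD eX p)) =
      StackMachine.certain isConstToken (.bot, [])
        ((p.wsd.cond.filter fun l => l.positive).map fun l =>
          (l.lhs.token eD eX, l.rhs.token eD eX))
        ((p.wsd.cond.filter fun l => !l.positive).map fun l =>
          (l.lhs.token eD eX, l.rhs.token eD eX))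
        (p.wsd.comps.map fun C => C.rows.map fun w => C.ids.attach.map fun s =>
          relTokens eD eX s.1.rel (w s))
        (p.inst.map fun f => relTokens eD eX f.1 fun j => some (.const (f.2 j))) := by
  rw [parse_encInput, decideParse]
  congr 1
  · dsimp only
    rw [List.filter_map, List.map_map]
    congr 1
    refine List.filter_congr fun l _ => ?_
    rcases l with ⟨_ | _, a, b⟩ <;> rfl
  · dsimp only
    rw [List.filter_map, List.map_map]
    congr 1
    refine List.filter_congr fun l _ => ?_
    rcases l with ⟨_ | _, a, b⟩ <;> rfl
  · simp [componentTokens, rowTokens, Function.comp_def]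
  -- In a row the relation number follows the tuple number and so is stored with an `eow` token,
  -- whereas in a fact it directly follows `tup`; `factKey` removes this difference.
  · simp [factKey, factTokens, relTokens, Function.comp_def]

end

/-! ### Solved equations and valuations -/

section

variable {T U : Type} [DecidableEq T] [DecidableEq U]

/-- Together with `solve_map` this transfers the computation on tokens to terms. -/
theorem subst_map {φ : T → U} (hφ : Injective φ) (θ : List (T × T)) (t : T) :
    subst (θ.map (Prod.map φ φ)) (φ t) = φ (subst θ t) := by
  induction θ generalizing t with
  | nil => rfl
  | cons e θ ih =>
    simp only [subst, List.map_cons, List.foldl_cons, Prod.map_fst, Prod.map_snd, hφ.eq_iff] at ih ⊢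
    rw [← ih]
    split_ifs <;> rfl

theorem subst_of_forall_ne {θ : List (T × T)} {t : T} (h : ∀ e ∈ θ, t ≠ e.1) : subst θ t = t := by
  induction θ with
  | nil => rfl
  | cons e θ ih =>
    rw [subst, List.foldl_cons, if_neg (h e List.mem_cons_self)]
    exact ih fun e he => h e (List.mem_cons_of_mem _ he)

theorem solve_append_singleton (c : T → Bool) (E : List (T × T)) (e : T × T) :
    solve c (E ++ [e]) =
      solve c E ++ [orient c (subst (solve c E) e.1) (subst (solve c E) e.2)] := by
  rw [solve, List.foldl_append]; rfl

theorem solve_map {φ : T → U} (hφ : Injective φ) {c : T → Bool} {c' : U → Bool}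
    (hc : ∀ t, c' (φ t) = c t) (E : List (T × T)) :
    solve c' (E.map (Prod.map φ φ)) = (solve c E).map (Prod.map φ φ) := by
  induction E using List.reverseRecOn with
  | nil => rfl
  | append_singleton E e ih =>
    rw [List.map_append, List.map_cons, List.map_nil, solve_append_singleton,
      solve_append_singleton, ih]
    simp only [List.map_cons, List.map_nil, orient, Prod.map_fst, Prod.map_snd, subst_map hφ, hc, List.map_append]
    split_ifs <;> rfl

theorem subst_append (θ θ' : List (T × T)) (t : T) :
    subst (θ ++ θ') t = subst θ' (subst θ t) := List.foldl_append

/-- Later substitutions act on the results of earlier ones, so sides already made equal stay equal;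
the entry added for the last equation identifies its two sides, in either orientation. -/
theorem subst_solve_eq (c : T → Bool) (E : List (T × T)) {e : T × T} (he : e ∈ E) :
    subst (solve c E) e.1 = subst (solve c E) e.2 := by
  induction E using List.reverseRecOn with
  | nil => simp at he
  | append_singleton E e' ih =>
    rw [solve_append_singleton, subst_append, subst_append]
    rcases List.mem_append.1 he with he | he
    · rw [ih he]
    · rw [List.mem_singleton.1 he]
      simp only [subst, orient, List.foldl_cons, List.foldl_nil]
      split_ifs <;> simp_all

/-- An equation of `solve c E` with a constant on its left side has a constant on its right side. -/
theorem const_of_mem_solve (c : T → Bool) (E : List (T × T)) {e : T × T} (he : e ∈ solve c E)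
    (h : c e.1 = true) : c e.2 = true := by
  induction E using List.reverseRecOn with
  | nil => simp [solve] at he
  | append_singleton E e' ih =>
    rw [solve_append_singleton] at he
    rcases List.mem_append.1 he with he | he
    · exact ih he
    · rw [List.mem_singleton.1 he] at h ⊢
      unfold orient at h ⊢
      split_ifs at h ⊢ <;> simp_all

variable {V : Type} {v : T → V}

theorem eval_subst {θ : List (T × T)} (h : ∀ e ∈ θ, v e.1 = v e.2) (t : T) :
    v (subst θ t) = v t := by
  induction θ generalizing t with
  | nil => rfl
  | cons e θ ih =>
    have := ih (fun e he => h e (List.mem_cons_of_mem _ he)) (if t = e.1 then e.2 else t)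
    rw [subst, List.foldl_cons]
    refine this.trans ?_
    split_ifs with ht
    · rw [ht, h e List.mem_cons_self]
    · rfl

/-- The entries are consequences of the equations, as substituting equals does not change values. -/
theorem eval_solve (c : T → Bool) {E : List (T × T)} (h : ∀ e ∈ E, v e.1 = v e.2) :
    ∀ e ∈ solve c E, v e.1 = v e.2 := by
  induction E using List.reverseRecOn with
  | nil => simp [solve]
  | append_singleton E e' ih =>
    have ih := ih fun e he => h e (by simp [he])
    have h' := h e' (by simp)
    intro e he
    rw [solve_append_singleton] at he
    rcases List.mem_append.1 he with he | he
    · exact ih e he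
    · rw [List.mem_singleton.1 he]
      unfold orient
      split_ifs <;> simp only [eval_subst ih, h']

/-- The hypothesis says that no clash of constants was found: `orient` puts a constant on the left
only if both sides are constants. -/
theorem subst_of_const {c : T → Bool} {θ : List (T × T)}
    (h : ∀ e ∈ θ, c e.1 = true → e.1 = e.2) {t : T} (ht : c t = true) : subst θ t = t := by
  induction θ with
  | nil => rfl
  | cons e θ ih =>
    have ih := ih fun e he => h e (List.mem_cons_of_mem _ he)
    rw [subst, List.foldl_cons]
    split_ifs with hte
    · rw [← h e List.mem_cons_self (hte ▸ ht), ← hte]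
      exact ih
    · exact ih

end

/-! ### Satisfiability of conditions and generic valuations -/

section

variable {D X : Type}

/-- Is a term a constant? -/
def Term.isConst : Term D X → Bool
  | .const _ => true
  | .var _ => false

/-- The encoding `eX` makes the set of variables countable, so it embeds into the infinite
complement of `F`. -/
theorem exists_injective_notMem [Infinite D] (eX : X ↪ List Bool) (F : Finset D) :
    ∃ h : X → D, Injective h ∧ ∀ x, h x ∉ F := by
  have : Infinite {d : D // d ∉ F} := F.finite_toSet.infinite_compl.to_subtype
  let g : ℕ ↪ {d : D // d ∉ F} := Infinite.natEmbedding _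
  exact ⟨fun x => g (Encodable.encode (eX x)),
    fun x y hxy => eX.injective (Encodable.encode_injective (g.injective (Subtype.ext hxy))),
    fun x => (g _).2⟩

/-- The equations of a condition. -/
def Condition.eqs (φ : Condition D X) : List (Term D X × Term D X) :=
  (φ.filter fun l => l.positive).map fun l => (l.lhs, l.rhs)

/-- The inequations of a condition. -/
def Condition.neqs (φ : Condition D X) : List (Term D X × Term D X) :=
  (φ.filter fun l => !l.positive).map fun l => (l.lhs, l.rhs)

theorem Condition.holds_iff {φ : Condition D X} {ν : X → D} : φ.Holds ν ↔
    (∀ e ∈ φ.eqs, e.1.eval ν = e.2.eval ν) ∧ ∀ e ∈ φ.neqs, e.1.eval ν ≠ e.2.eval ν := by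
  simp only [Condition.Holds, Literal.Holds, eqs, neqs, List.mem_map, List.mem_filter,
    Bool.not_eq_true', forall_exists_index, and_imp]
  constructor
  · refine fun h => ⟨?_, ?_⟩
    · rintro _ l hl hp rfl
      simpa [hp] using h l hl
    · rintro _ l hl hp rfl
      simpa [hp] using h l hl
  · rintro ⟨h1, h2⟩ l hl
    cases hp : l.positive
    · simpa using h2 _ l hl hp rfl
    · simpa using h1 _ l hl hp rfl

open scoped Classical in
/-- The solution of the equations of a condition. -/
noncomputable def Condition.solution (φ : Condition D X) : List (Term D X × Term D X) :=
  solve Term.isConst φ.eqs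

open scoped Classical in
/-- The inconsistency of a condition, as found by solving its equations. -/
def Condition.Bad (φ : Condition D X) : Prop :=
  (∃ e ∈ φ.solution, e.1.isConst = true ∧ e.1 ≠ e.2) ∨
    ∃ e ∈ φ.neqs, subst φ.solution e.1 = subst φ.solution e.2

open scoped Classical in
theorem Condition.Holds.eval_subst {φ : Condition D X} {ν : X → D} (h : φ.Holds ν)
    (t : Term D X) : (subst φ.solution t).eval ν = t.eval ν :=
  WSD.eval_subst (v := Term.eval ν) (eval_solve _ (holds_iff.1 h).1) t

/-- A satisfaction would identify two distinct constants, or give equal values to the sides of an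
inequality. -/
theorem Condition.Bad.not_holds {φ : Condition D X} (h : φ.Bad) (ν : X → D) : ¬φ.Holds ν := by
  classical
  intro hν
  rcases h with ⟨⟨a, b⟩, he, hc, hne⟩ | ⟨e, he, h⟩
  · have h1 := eval_solve (v := Term.eval ν) _ (holds_iff.1 hν).1 _ he
    have h2 := const_of_mem_solve _ _ he hc
    cases a <;> cases b <;> simp_all [Term.isConst, Term.eval]
  · have h1 := hν.eval_subst e.1
    rw [h, hν.eval_subst e.2] at h1
    exact (holds_iff.1 hν).2 e he h1.symm

open scoped Classical in
/-- A consistent condition has a satisfaction under which only those terms have a value in a given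
finite set that are forced to have it. -/
theorem Condition.exists_holds [Infinite D] (eX : X ↪ List Bool) {φ : Condition D X}
    (hφ : ¬φ.Bad) (F : Finset D) : ∃ ν : X → D, φ.Holds ν ∧
      ∀ t : Term D X, ∀ d ∈ F, t.eval ν = d → subst φ.solution t = .const d := by
  simp only [Condition.Bad, not_or, not_exists, not_and, not_not] at hφ
  obtain ⟨hc, hn⟩ := hφ
  let cs : Term D X → Finset D := fun t => match t with
    | .const d => {d}
    | .var _ => ∅
  -- Fresh values must avoid `F` and also the constants to which sides of inequalities are reduced,
  -- lest an inequality fail by coincidence.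
  obtain ⟨h, hinj, hF⟩ := exists_injective_notMem eX (F ∪ (φ.neqs.toFinset.biUnion fun e =>
    cs (subst φ.solution e.1) ∪ cs (subst φ.solution e.2)))
  -- The valuation is substitution followed by `h`; this extends to constants because substitution
  -- fixes them.
  have hν : ∀ t : Term D X, t.eval (fun x => (subst φ.solution (.var x)).eval h) =
      (subst φ.solution t).eval h := by
    rintro (d | x)
    · rw [subst_of_const (c := Term.isConst) hc rfl]; rfl
    · rfl
  refine ⟨fun x => (subst φ.solution (.var x)).eval h, holds_iff.2 ⟨fun e he => ?_,
    fun e he => ?_⟩, fun t d hd ht => ?_⟩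
  · rw [hν, hν, Condition.solution, subst_solve_eq _ _ he]
  · rw [hν, hν]
    have hne := hn e he
    have hcs : ∀ x, h x ∉ cs (subst φ.solution e.1) ∧ h x ∉ cs (subst φ.solution e.2) := by
      intro x
      have := hF x
      simp only [Finset.mem_union, Finset.mem_biUnion, List.mem_toFinset, not_or, not_exists,
        not_and] at this
      exact this.2 e he
    -- The two reduced sides differ as terms. Distinct constants differ, a variable and a constant
    -- differ by freshness, and two variables by injectivity of `h`.
    rcases h1 : subst φ.solution e.1 with d | x <;> rcases h2 : subst φ.solution e.2 with d' | y <;>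
      rw [h1, h2] at hne hcs <;> simp only [Term.eval]
    · simpa using hne
    · have := (hcs y).1
      simp only [cs, Finset.mem_singleton] at this
      exact fun h => this h.symm
    · have := (hcs x).2
      simpa only [cs, Finset.mem_singleton] using this
    · exact fun h => hne (by rw [hinj h])
  · rw [hν] at ht
    rcases h1 : subst φ.solution t with d' | x
    · rw [h1] at ht
      rw [← ht]; rfl
    · rw [h1] at ht
      have := hF x
      simp only [Finset.mem_union, not_or] at this
      have ht' : h x = d := ht
      exact absurd (ht' ▸ hd) this.1

end

/-! ### Certain instances -/

section

variable {D X : Type} {S : Schema}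

/-- The rows of the components can be chosen independently. -/
theorem GWSD.exists_mem_product (W : GWSD S D X) (ρ : ∀ C ∈ W.comps, Row S D X C.ids)
    (hρ : ∀ C hC, ρ C hC ∈ C.rows) : ∃ w ∈ W.product, ∀ C hC (s : {s : TupleId S // s ∈ C.ids}),
      w ⟨s.1, List.mem_flatMap.2 ⟨C, hC, s.2⟩⟩ = ρ C hC s := by
  -- Disjointness of the column sets: an identifier determines its component.
  have huniq : ∀ C ∈ W.comps, ∀ C' ∈ W.comps, ∀ s ∈ C.ids, s ∈ C'.ids → C = C' := by
    intro C hC C' hC' s hs hs'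
    by_contra hne
    have : Std.Symm (List.Disjoint on Component.ids (S := S) (D := D) (X := X)) := ⟨fun _ _ h => h.symm⟩
    exact (List.nodup_flatMap.1 W.nodup).2.forall hC hC' hne hs hs'
  choose c hc hsc using fun s : {s : TupleId S // s ∈ W.ids} => List.mem_flatMap.1 s.2
  have key : ∀ C hC (s : {s : TupleId S // s ∈ C.ids}),
      ρ (c ⟨s.1, List.mem_flatMap.2 ⟨C, hC, s.2⟩⟩) (hc _) ⟨s.1, hsc _⟩ = ρ C hC s := by
    intro C hC s
    have h := huniq C hC _ (hc ⟨s.1, List.mem_flatMap.2 ⟨C, hC, s.2⟩⟩) s.1 s.2 (hsc _)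
    -- The type of a row depends on its component, so the equality of components is eliminated with
    -- the component generalized.
    have aux : ∀ C' hC' (hs : s.1 ∈ C'.ids), C = C' → ρ C' hC' ⟨s.1, hs⟩ = ρ C hC s := by
      rintro C' hC' hs rfl
      rfl
    exact aux _ _ _ h
  refine ⟨fun s => ρ (c s) (hc s) ⟨s.1, hsc s⟩, fun C hC => ?_, key⟩
  convert hρ C hC using 1
  exact funext fun s => key C hC s

open scoped Classical in
/-- The tuple `x` of the relation `R` becomes the fact `f` if the equations of `φ` are solved. -/
def Resolves (φ : Condition D X) (f : (R : S.Rel) × Tuple S R D) (R : S.Rel)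
    (x : Tuple S R (Field D X)) : Prop :=
  (⟨f.1, fun j => some (.const (f.2 j))⟩ : (R : S.Rel) × Tuple S R (Field D X)) =
    ⟨R, fun j => (x j).map (subst φ.solution)⟩

open scoped Classical in
theorem resolves_iff {φ : Condition D X} {R : S.Rel} {t : Tuple S R D}
    {x : Tuple S R (Field D X)} : Resolves φ ⟨R, t⟩ R x ↔
      ∀ j, (x j).map (subst φ.solution) = some (.const (t j)) := by
  rw [Resolves, Sigma.mk.inj_iff, heq_eq_eq, funext_iff]
  simp [eq_comm]

theorem Resolves.rel_eq {φ : Condition D X} {f : (R : S.Rel) × Tuple S R D} {R : S.Rel}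
    {x : Tuple S R (Field D X)} (h : Resolves φ f R x) : f.1 = R := congrArg Sigma.fst h

/-- A tuple that becomes a fact has this fact as its value under every satisfaction. -/
theorem Resolves.exists_eval {φ : Condition D X} {R : S.Rel} {t : Tuple S R D}
    {x : Tuple S R (Field D X)} (h : Resolves φ ⟨R, t⟩ R x) {ν : X → D} (hν : φ.Holds ν) :
    ∃ y : Tuple S R (Term D X), (∀ j, x j = some (y j)) ∧ ∀ j, (y j).eval ν = t j := by
  classical
  have h' : ∀ j, ∃ y, x j = some y ∧ y.eval ν = t j := by
    intro j
    have hj := resolves_iff.1 h j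
    obtain ⟨y, hy, hy'⟩ := Option.map_eq_some_iff.1 hj
    refine ⟨y, hy, ?_⟩
    rw [← hν.eval_subst, hy']
    rfl
  choose y hy hy' using h'
  exact ⟨y, hy, hy'⟩

/-- Necessity uses one generic valuation, fresh with respect to all values in the instance, and
varies the row of the product. Sufficiency holds because a tuple resolving to a fact evaluates to it
under every satisfaction, whichever rows are chosen elsewhere. -/
theorem instanceCertain_iff [Infinite D] (eX : X ↪ List Bool) (p : Input D X) :
    InstanceCertain p ↔ (∃ C ∈ p.wsd.comps, C.rows = []) ∨ p.wsd.cond.Bad ∨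
      ((∀ C ∈ p.wsd.comps, ∀ w ∈ C.rows, ∀ s : {s // s ∈ C.ids},
        (∃ j, w s j = none) ∨ ∃ f ∈ p.inst, Resolves p.wsd.cond f s.1.rel (w s)) ∧
      ∀ f ∈ p.inst, ∃ C ∈ p.wsd.comps, ∀ w ∈ C.rows, ∃ s : {s // s ∈ C.ids},
        Resolves p.wsd.cond f s.1.rel (w s)) := by
  classical
  obtain ⟨S, W, I⟩ := p
  dsimp only
  constructor
  · intro hcert
    by_cases h0 : ∃ C ∈ W.comps, C.rows = []
    · exact .inl h0
    by_cases hbad : W.cond.Bad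
    · exact .inr (.inl hbad)
    obtain ⟨ν, hν, hF⟩ := W.cond.exists_holds eX hbad
      (I.toFinset.biUnion fun f => Finset.univ.image f.2)
    have hmem : ∀ f ∈ I, ∀ j, f.2 j ∈ I.toFinset.biUnion fun f => Finset.univ.image f.2 :=
      fun f hf j => Finset.mem_biUnion.2 ⟨f, List.mem_toFinset.2 hf, Finset.mem_image_of_mem _
        (Finset.mem_univ j)⟩
    have hworld : ∀ w ∈ W.product, Instance.toDatabase I = (uninline w W.cond).apply ν :=
      fun w hw => hcert _ (Set.mem_biUnion hw ⟨ν, hν, rfl⟩)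
    have hresolve : ∀ f ∈ I, ∀ y : Tuple S f.1 (Term D X), (∀ j, (y j).eval ν = f.2 j) →
        Resolves W.cond f f.1 (fun j => some (y j)) := by
      rintro ⟨R, t⟩ hf y hy
      exact resolves_iff.2 fun j => congrArg some (hF _ _ (hmem _ hf j) (hy j))
    push Not at h0
    refine .inr (.inr ⟨fun C hC w₀ hw₀ s => ?_, fun f hf => ?_⟩)
    -- The given row `w₀` of `C` is completed by arbitrary rows of the other, nonempty components;
    -- the transport along `C' = C` records that `w₀` is used for `C` itself.
    · have hrow : ∀ C' ∈ W.comps, ∃ r ∈ C'.rows, ∀ h : C' = C, h ▸ r = w₀ := by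
        intro C' hC'
        by_cases h : C' = C
        · subst h
          exact ⟨w₀, hw₀, fun _ => rfl⟩
        · obtain ⟨r, hr⟩ := List.exists_mem_of_ne_nil _ (h0 C' hC')
          exact ⟨r, hr, fun h' => absurd h' h⟩
      choose ρ hρ hρ' using hrow
      obtain ⟨w, hw, hwρ⟩ := W.exists_mem_product ρ hρ
      have hws : w ⟨s.1, List.mem_flatMap.2 ⟨C, hC, s.2⟩⟩ = w₀ s := by
        rw [hwρ C hC s]
        exact congrFun (hρ' C hC rfl) s
      by_cases hnone : ∃ j, w₀ s j = none
      · exact .inl hnone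
      push Not at hnone
      choose y hy using fun j => Option.ne_none_iff_exists'.1 (hnone j)
      have hA : (fun j => (y j).eval ν) ∈ (uninline w W.cond).apply ν s.1.rel :=
        ⟨y, ⟨s.1.num, List.mem_flatMap.2 ⟨C, hC, s.2⟩, fun j => by rw [← hy j, ← hws]⟩, rfl⟩
      rw [← hworld w hw] at hA
      refine .inr ⟨_, hA, ?_⟩
      rw [show w₀ s = fun j => some (y j) from funext hy]
      exact hresolve _ hA y fun j => rfl
    · by_contra hno
      push Not at hno
      -- Every component has a row without a tuple resolving to `f`. The world built from these rows
      -- equals the instance, so some tuple has value `f` under the generic valuation and hence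
      -- resolves to `f`, a contradiction.
      choose ρ hρ hρ' using hno
      obtain ⟨w, hw, hwρ⟩ := W.exists_mem_product ρ hρ
      have hA : f.2 ∈ Instance.toDatabase I f.1 := hf
      rw [hworld w hw] at hA
      obtain ⟨y, ⟨d, hd, hy⟩, hyf⟩ := hA
      obtain ⟨C, hC, hs⟩ := List.mem_flatMap.1 hd
      refine hρ' C hC ⟨_, hs⟩ ?_
      rw [← hwρ C hC ⟨_, hs⟩]
      have := hresolve f hf y fun j => congrFun hyf j
      rwa [← funext hy] at this
  · intro h A hA
    simp only [GWSD.rep, repGTST, Set.mem_iUnion] at hA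
    obtain ⟨w, hw, ν, hν, rfl⟩ := hA
    rcases h with ⟨C, hC, h⟩ | hbad | ⟨h1, h2⟩
    · have := hw C hC
      rw [h] at this
      simp at this
    · exact absurd hν (hbad.not_holds ν)
    · funext R
      ext t
      constructor
      · intro ht
        obtain ⟨C, hC, h⟩ := h2 ⟨R, t⟩ ht
        obtain ⟨⟨⟨R', d⟩, hs⟩, hr⟩ := h _ (hw C hC)
        obtain rfl : R = R' := hr.rel_eq
        obtain ⟨y, hy, hyt⟩ := hr.exists_eval hν
        exact ⟨y, ⟨d, List.mem_flatMap.2 ⟨C, hC, hs⟩, hy⟩, funext hyt⟩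
      · rintro ⟨y, ⟨d, hd, hy⟩, rfl⟩
        obtain ⟨C, hC, hs⟩ := List.mem_flatMap.1 hd
        rcases h1 C hC _ (hw C hC) ⟨_, hs⟩ with ⟨j, hj⟩ | ⟨⟨R', t⟩, hf, hr⟩
        · have := (hy j).symm.trans hj
          simp at this
        · obtain rfl : R' = R := hr.rel_eq
          obtain ⟨y', hy', ht⟩ := hr.exists_eval hν
          have : y = y' := funext fun j => Option.some_injective _ ((hy j).symm.trans (hy' j))
          subst this
          change (fun j => (y j).eval ν) ∈ Instance.toDatabase I R'
          rw [show (fun j => (y j).eval ν) = t from funext ht]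
          exact hf

end

/-! ### Correctness of the decision procedure -/

section

variable {D X : Type} (eD : D ↪ List Bool) (eX : X ↪ List Bool) {S : Schema}

theorem bit_injective : Injective Sym.bit := fun _ _ h => Sym.bit.inj h

theorem token_injective : Injective (Term.token eD eX) := by
  have h := List.map_injective_iff.2 bit_injective
  rintro (d | x) (d' | y) hxy <;> simp only [Term.token, Prod.mk.injEq, reduceCtorEq,
    true_and, false_and] at hxy
  · rw [eD.injective (h hxy)]
  · rw [eX.injective (h hxy)]

theorem isConstToken_token (t : Term D X) : isConstToken (t.token eD eX) = t.isConst := by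
  cases t <;> rfl

/-- Tokens of terms cannot be confused with the end marker or with `⊥`; hence substitutions leave
those markers alone. -/
theorem fst_token_ne (t : Term D X) : (t.token eD eX).1 ≠ .eow ∧ (t.token eD eX).1 ≠ .bot := by
  cases t <;> simp [Term.token]

theorem bot_mem_relTokens {R : S.Rel} {t : Tuple S R (Field D X)} :
    ((Sym.bot, []) : Token) ∈ relTokens eD eX R t ↔ ∃ j, t j = none := by
  simp only [relTokens, tupleTokens, List.mem_cons, Prod.mk.injEq, reduceCtorEq, false_and,
    false_or, List.mem_flatMap, List.mem_ofFn]
  constructor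
  · rintro ⟨_, ⟨j, rfl⟩, hj⟩
    refine ⟨j, ?_⟩
    rcases h : t j with _ | u
    · rfl
    · rw [h] at hj
      have := (fst_token_ne eD eX u).2
      simp only [fieldTokens, List.mem_cons, Prod.mk.injEq, reduceCtorEq, false_and,
        List.not_mem_nil, or_false] at hj
      exact absurd (congrArg Prod.fst hj).symm this
  · rintro ⟨j, hj⟩
    exact ⟨_, ⟨j, rfl⟩, by simp [hj, fieldTokens]⟩

theorem natBits_injective : Injective natBits := by
  intro m n h
  have := List.map_injective_iff.2 bit_injective h
  rw [← Computability.decode_encodeNat m, this, Computability.decode_encodeNat]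

theorem fieldTokens_append_inj {f g : Field D X} {r s : List Token}
    (h : fieldTokens eD eX f ++ r = fieldTokens eD eX g ++ s) : f = g ∧ r = s := by
  rcases f with _ | t <;> rcases g with _ | u <;>
    simp only [fieldTokens, List.cons_append, List.nil_append, List.cons.injEq, true_and] at h
  · exact ⟨rfl, h⟩
  · exact absurd (congrArg Prod.fst h.1).symm (fst_token_ne eD eX u).2
  · exact absurd (congrArg Prod.fst h.1) (fst_token_ne eD eX t).2
  · exact ⟨by rw [token_injective eD eX h.1], h.2⟩

theorem tupleTokens_injective {n : ℕ} :
    Injective (tupleTokens eD eX : (Fin n → Field D X) → List Token) := by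
  intro t u h
  suffices h : ∀ l l' : List (Field D X), l.length = l'.length →
      l.flatMap (fieldTokens eD eX) = l'.flatMap (fieldTokens eD eX) → l = l' from
    List.ofFn_injective (h _ _ (by simp) ‹_›)
  intro l
  induction l with
  | nil => intro l' hl _; exact (List.length_eq_zero_iff.1 hl.symm).symm
  | cons f l ih =>
    rintro (_ | ⟨g, l'⟩) hl h
    · simp at hl
    · obtain ⟨h1, h2⟩ := fieldTokens_append_inj eD eX h
      rw [h1, ih l' (by simpa using hl) h2]

/-- The relation number is part of the key, so equal tuples of different relations are told apart.
-/
theorem relTokens_eq_iff {R R' : S.Rel} {t : Tuple S R (Field D X)}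
    {t' : Tuple S R' (Field D X)} : relTokens eD eX R t = relTokens eD eX R' t' ↔
      (⟨R, t⟩ : (R : S.Rel) × Tuple S R (Field D X)) = ⟨R', t'⟩ := by
  constructor
  · intro h
    simp only [relTokens, List.cons.injEq, Prod.mk.injEq, true_and] at h
    obtain rfl : R = R' := Fin.ext (natBits_injective h.1)
    rw [tupleTokens_injective eD eX h.2]
  · intro h
    cases h
    rfl

open scoped Classical in
theorem subst_relTokens (θ : List (Term D X × Term D X)) (R : S.Rel)
    (t : Tuple S R (Field D X)) :
    (relTokens eD eX R t).map
        (subst (θ.map (Prod.map (Term.token eD eX) (Term.token eD eX)))) =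
      relTokens eD eX R (fun j => (t j).map (subst θ)) := by
  have h : ∀ (s : Sym) (w : List Sym), s = .eow ∨ s = .bot →
      subst (θ.map (Prod.map (Term.token eD eX) (Term.token eD eX))) (s, w) = (s, w) := by
    intro s w hs
    refine subst_of_forall_ne fun e he => ?_
    obtain ⟨e, -, rfl⟩ := List.mem_map.1 he
    have := fst_token_ne eD eX e.1
    rintro h
    rw [Prod.map_fst] at h
    rw [← h] at this
    rcases hs with rfl | rfl <;> simp at this
  simp only [relTokens, List.map_cons, h _ _ (.inl rfl), tupleTokens, List.ofFn_eq_map,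
    List.flatMap_map, List.map_flatMap]
  congr 3
  funext j
  rcases t j with _ | u
  · simp [fieldTokens, h _ _ (.inr rfl)]
  · simp [fieldTokens, h _ _ (.inl rfl), subst_map (token_injective eD eX)]

/-- Tokens represent terms injectively and respect constants, so each test of `certain` becomes the
corresponding clause of `instanceCertain_iff`. -/
theorem decideParse_iff [Infinite D] (p : Input D X) :
    decideParse (parse (encInput eD eX p)) = true ↔ InstanceCertain p := by
  classical
  have h1 : solve isConstToken ((p.wsd.cond.filter fun l => l.positive).map fun l =>
      (l.lhs.token eD eX, l.rhs.token eD eX)) =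
      p.wsd.cond.solution.map (Prod.map (Term.token eD eX) (Term.token eD eX)) := by
    rw [Condition.solution, ← solve_map (token_injective eD eX) (isConstToken_token eD eX),
      Condition.eqs, List.map_map]
    rfl
  rw [decideParse_encInput, instanceCertain_iff eX, certain, h1]
  simp only [Bool.or_eq_true, Bool.and_eq_true, List.any_eq_true, List.all_eq_true, List.mem_map,
    exists_exists_and_eq_and, forall_exists_index, and_imp, forall_apply_eq_imp_iff₂,
    decide_eq_true_eq, subst_relTokens, relTokens_eq_iff, List.mem_attach, true_and,
    exists_exists_eq_and, forall_apply_eq_imp_iff, List.isEmpty_iff, List.map_eq_nil_iff,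
    Resolves, or_assoc, Condition.Bad, Condition.neqs, Prod.map_fst, Prod.map_snd,
    isConstToken_token, subst_map (token_injective eD eX), (token_injective eD eX).eq_iff,
    Bool.not_eq_true', decide_eq_false_iff_not, exists_eq_right, bot_mem_relTokens]

end

end WSD

theorem mainTheorem5 {D X : Type} [Infinite D] (eD : D ↪ List Bool) (eX : X ↪ List Bool) :
    WSD.InPTIME (WSD.encInput eD eX) (WSD.InstanceCertain (D := D) (X := X)) := by
  refine ⟨fun p => WSD.decideParse (WSD.parse (WSD.encInput eD eX p)), WSD.decideParse_iff eD eX,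
    (WSD.polyTime_decideParse.comp WSD.polyTime_parse).nonempty_tm2ComputableInPolyTime _ fun p => ?_⟩
  -- The reversal caused by loading the input cancels the one in `polyTime_parse`.
  rw [List.reverse_reverse]
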